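/- **Setting.** A pointed $k$-chain in $\mathbb R^2$ is a finite formal sum $A=\sum_i(p_i;\alpha_i)$ with $p_i\in\mathbb R^2$ and $\alpha_i\in\Lambda^k\mathbb R^2$. For $u\in\mathbb R^2$ let $\Delta_u(p;\alpha)=(p+u;\alpha)-(p;\alpha)$, extended linearly, and for a list $U=(u_1,\dots,u_j)$ let $\Delta_U^j=\Delta_{u_1}\circ\cdots\circ\Delta_{u_j}$ and $|\Delta_U^j(p;\alpha)|_j=\|u_1\|\cdots\|u_j\|\,\|\alpha\|$, where $\|\alpha\|$ is the mass of $\alpha$. For $r\ge 0$ put $$\|A\|_{B^r}=\inf\Big\{\sum_i|\Delta_{U_i}^{j_i}(p_i;\alpha_i)|_{j_i}\;:\;A=\sum_i\Delta_{U_i}^{j_i}(p_i;\alpha_i)\text{ (finite sum)},\ j_i\le r\Big\}.$$ The space $\hat{\mathcal B}_k^r(\mathbb R^2)$ of differential $k$-chains of order $r$ is the completion of the pointed $k$-chains in this norm. For $r\le s$ there is a canonical map $\hat{\mathcal B}_k^r\to\hat{\mathcal B}_k^s$, and identities between chains of different orders are understood in the inductive limit of these spaces. A form $\omega$ is of class $\mathcal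 B^r$ if $|\omega(\Delta_U^j(p;\alpha))|\le C\,|\Delta_U^j(p;\alpha)|_j$ for some constant $C$, all $j\le r$ and all $U,p,\alpha$; the integral $\int_J\omega$ of such a $k$-form over $J\in\hat{\mathcal B}_k^r$ is the continuous extension of $\sum_i(p_i;\alpha_i)\mapsto\sum_i\omega_{p_i}(\alpha_i)$. A function $f$ of class $\mathcal B^r$ acts on $\hat{\mathcal B}_k^r$ by the continuous extension $m_f$ of $(p;\alpha)\mapsto(p;f(p)\alpha)$. For $r\ge1$ the boundary $\partial:\hat{\mathcal B}_k^r\to\hat{\mathcal B}_{k-1}^{r+1}$ is $\sum_i P_{e_i}E_{e_i}^\dagger$, where $P_v(p;\alpha)=\lim_{t\to0}\Delta_{tv}(p;\alpha/t)$ and $E_v^\dagger(p;v_1\wedge\cdots\wedge v_k)=\sum_i(-1)^{i+1}\langle v,v_i\rangle(p;v_1\wedge\cdots\widehat{v_i}\cdots\wedge v_k)$; $J$ is closed if $\partial J=0$. The support $\operatorname{supp}J$ is the intersection of all closed sets $X$ such that, for every nonempty open $W\supseteq X$, $J$ is a limit of pointed chains in $W$. The mass of $K$ is $\inf\{\liminf_i\|A_i\|_{B^0}\}$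 over all sequences of pointed chains $A_i\to K$. For $z\notin\operatorname{supp}J$ the winding number is $\mathrm{Ind}_J(z)=\frac1{2\pi i}\int_J\frac{dw}{w-z}$, computed with any $1$-form of class $\mathcal B^r$ on $\mathbb R^2\simeq\mathbb C$ that agrees with $\frac{dw}{w-z}$ on a neighbourhood of $\operatorname{supp}J$. The signed density of a $2$-chain $K$ of order $s$ and finite mass at $x$ is $$\lim_{\epsilon\to0}\frac1{\operatorname{vol}(B_\epsilon)}\int_{K\lfloor B_\epsilon}dv,$$ where $B_\epsilon$ is the open ball of radius $\epsilon$ about $x$ and the restriction $K\lfloor B_\epsilon$ is the limit of $m_{f_i}K$ for any functions $0\le f_i\le1$ of class $\mathcal B^s$ that vanish off $B_\epsilon$ and converge pointwise to $1$ on $B_\epsilon$. **Theorem.** Let $r\ge1$, let $J\in\hat{\mathcal B}_1^r(\mathbb R^2)$ be closed, and let $K$ be a differential $2$-chain in $\mathbb R^2$, of any order, with finite mass and $\partial K=J$. Then for every $z\notin\operatorname{supp}(J)$ the winding number $\mathrm{Ind}_J(z)$ and the signed density of $K$ at $z$ exist (in particular $K\lfloor B_\epsilon$ exists for all sufficiently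 small $\epsilon>0$), and they are equal. Moreover $K$ is unique: every differential $2$-chain $K'$ of any order with $\partial K'=J$ is equal to $K$. -/

import Mathlib

open Filter Topology MeasureTheory

set_option linter.unusedSectionVars false

noncomputable section

namespace DiffChain

/-! Differential chains. A pointed chain `∑ (pᵢ; αᵢ)` in the space `E` with coefficients `αᵢ` in a
normed space `V` is a finitely supported function from `E` to `V`. -/

/-- Pointed chains in `E` with coefficients in `V`. -/
abbrev Pointed (E V : Type) [NormedAddCommGroup V] : Type := E →₀ V

section General

variable {E V W F : Type} [NormedAddCommGroup E] [NormedSpace ℝ E]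
  [NormedAddCommGroup V] [NormedSpace ℝ V] [NormedAddCommGroup W] [NormedSpace ℝ W]
  [NormedAddCommGroup F] [NormedSpace ℝ F]

/-- The simple element `(p; α)`. -/
abbrev elt (p : E) (α : V) : Pointed E V := Finsupp.single p α

/-- The translation operator `T_u`, `(p; α) ↦ (p + u; α)`. -/
def translate (u : E) : Pointed E V →ₗ[ℝ] Pointed E V :=
  Finsupp.lmapDomain V ℝ (fun p => p + u)

/-- The difference operator `Δ_u = T_u - Id`. -/
def diff (u : E) : Pointed E V →ₗ[ℝ] Pointed E V :=
  translate u - LinearMap.id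

/-- The iterated difference operator `Δ_U^j = Δ_{u₁} ∘ ⋯ ∘ Δ_{u_j}` for `U = [u₁, …, u_j]`. -/
def diffs : List E → (Pointed E V →ₗ[ℝ] Pointed E V)
  | [] => LinearMap.id
  | u :: U => (diff u).comp (diffs U)

/-- The size `‖u₁‖ ⋯ ‖u_j‖ ‖α‖` of the difference chain `Δ_U^j (p; α)`. -/
def size (U : List E) (α : V) : ℝ := (U.map fun u => ‖u‖).prod * ‖α‖

/-- The numbers `∑ |Δ_{Uᵢ}^{jᵢ} (pᵢ; αᵢ)|` over all finite decompositions
`A = ∑ Δ_{Uᵢ}^{jᵢ} (pᵢ; αᵢ)` with all `jᵢ ≤ r`. -/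
def decompositionSizes (r : ℕ) (A : Pointed E V) : Set ℝ :=
  {c | ∃ L : List (List E × E × V), (∀ x ∈ L, x.1.length ≤ r) ∧
    A = (L.map fun x => diffs x.1 (elt x.2.1 x.2.2)).sum ∧
    c = (L.map fun x => size x.1 x.2.2).sum}

/-- The `r`-norm `‖A‖_{B^r}` of a pointed chain; for `r = 0` it is the mass norm. -/
def rnorm (r : ℕ) (A : Pointed E V) : ℝ := sInf (decompositionSizes r A)

lemma size_nonneg (U : List E) (α : V) : 0 ≤ size U α := by
  unfold size
  refine mul_nonneg (List.prod_nonneg ?_) (norm_nonneg _)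
  intro a ha
  obtain ⟨u, -, rfl⟩ := List.mem_map.1 ha
  exact norm_nonneg u

lemma decompositionSizes_nonneg {r : ℕ} {A : Pointed E V} {c : ℝ}
    (hc : c ∈ decompositionSizes r A) : 0 ≤ c := by
  obtain ⟨L, -, -, rfl⟩ := hc
  refine List.sum_nonneg ?_
  intro a ha
  obtain ⟨x, -, rfl⟩ := List.mem_map.1 ha
  exact size_nonneg _ _

lemma decompositionSizes_bddBelow (r : ℕ) (A : Pointed E V) :
    BddBelow (decompositionSizes r A) :=
  ⟨0, fun _ hc => decompositionSizes_nonneg hc⟩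

lemma decompositionSizes_nonempty (r : ℕ) (A : Pointed E V) :
    (decompositionSizes r A).Nonempty := by
  induction A using Finsupp.induction_linear with
  | zero => exact ⟨0, [], by simp, by simp, by simp⟩
  | add f g hf hg =>
    obtain ⟨_, L, h1, h2, -⟩ := hf
    obtain ⟨_, L', h1', h2', -⟩ := hg
    refine ⟨_, L ++ L', ?_, ?_, rfl⟩
    · intro x hx
      rcases List.mem_append.1 hx with h | h
      exacts [h1 x h, h1' x h]
    · rw [List.map_append, List.sum_append, ← h2, ← h2']
  | single p α => exact ⟨_, [([], p, α)], by simp, by simp [diffs], rfl⟩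

lemma rnorm_nonneg (r : ℕ) (A : Pointed E V) : 0 ≤ rnorm r A :=
  Real.sInf_nonneg fun _ hc => decompositionSizes_nonneg hc

lemma rnorm_add_le (r : ℕ) (A B : Pointed E V) : rnorm r (A + B) ≤ rnorm r A + rnorm r B := by
  refine le_of_forall_pos_le_add fun ε hε => ?_
  obtain ⟨a, ha, ha'⟩ := exists_lt_of_csInf_lt (decompositionSizes_nonempty r A)
    (show sInf (decompositionSizes r A) < rnorm r A + ε / 2 by unfold rnorm; linarith)
  obtain ⟨b, hb, hb'⟩ := exists_lt_of_csInf_lt (decompositionSizes_nonempty r B)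
    (show sInf (decompositionSizes r B) < rnorm r B + ε / 2 by unfold rnorm; linarith)
  have : rnorm r (A + B) ≤ a + b := by
    refine csInf_le (decompositionSizes_bddBelow _ _) ?_
    obtain ⟨L, h1, h2, rfl⟩ := ha
    obtain ⟨L', h1', h2', rfl⟩ := hb
    refine ⟨L ++ L', ?_, ?_, ?_⟩
    · intro x hx
      rcases List.mem_append.1 hx with h | h
      exacts [h1 x h, h1' x h]
    · rw [List.map_append, List.sum_append, ← h2, ← h2']
    · rw [List.map_append, List.sum_append]
  linarith

lemma rnorm_diffs_le {r : ℕ} {U : List E} (hU : U.length ≤ r) (p : E) (α : V) :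
    rnorm r (diffs U (elt p α)) ≤ size U α :=
  csInf_le (decompositionSizes_bddBelow _ _) ⟨[(U, p, α)], by simpa using hU, by simp, by simp⟩

lemma rnorm_zero (r : ℕ) : rnorm r (0 : Pointed E V) = 0 := by
  refine le_antisymm ?_ (rnorm_nonneg _ _)
  exact csInf_le (decompositionSizes_bddBelow _ _) ⟨[], by simp, by simp, by simp⟩

/-- A subadditive function that is at most `C` times the size on difference chains of order at most
`r` is at most `C` times the `r`-norm. -/
lemma le_mul_rnorm {r : ℕ} (f : Pointed E V → ℝ) (h0 : f 0 ≤ 0)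
    (hadd : ∀ A B, f (A + B) ≤ f A + f B) {C : ℝ} (hC : 0 ≤ C)
    (h : ∀ U : List E, U.length ≤ r → ∀ (p : E) (α : V),
      f (diffs U (elt p α)) ≤ C * size U α) (A : Pointed E V) :
    f A ≤ C * rnorm r A := by
  have key : ∀ c ∈ decompositionSizes r A, f A ≤ C * c := by
    rintro c ⟨L, h1, rfl, rfl⟩
    induction L with
    | nil => simpa using h0
    | cons x L ih =>
      simp only [List.map_cons, List.sum_cons, mul_add]
      refine (hadd _ _).trans (add_le_add (h _ (h1 x (by simp)) _ _) ?_)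
      exact ih fun y hy => h1 y (by simp [hy])
  rcases hC.eq_or_lt with rfl | hC
  · obtain ⟨c, hc⟩ := decompositionSizes_nonempty r A
    simpa using key c hc
  · rw [← div_le_iff₀' hC]
    refine le_csInf (decompositionSizes_nonempty r A) fun c hc => ?_
    rw [div_le_iff₀' hC]
    exact key c hc

lemma size_smul (U : List E) (a : ℝ) (α : V) : size U (a • α) = |a| * size U α := by
  simp only [size, norm_smul, Real.norm_eq_abs]; ring

lemma rnorm_smul_le (r : ℕ) (a : ℝ) (A : Pointed E V) : rnorm r (a • A) ≤ |a| * rnorm r A := by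
  refine le_mul_rnorm (fun A => rnorm r (a • A)) ?_ ?_ (abs_nonneg a) ?_ A
  · simp [rnorm_zero]
  · intro A B; simpa using rnorm_add_le r (a • A) (a • B)
  · intro U hU p α
    rw [← size_smul, ← map_smul, Finsupp.smul_single]
    exact rnorm_diffs_le hU p _

lemma rnorm_smul (r : ℕ) (a : ℝ) (A : Pointed E V) : rnorm r (a • A) = |a| * rnorm r A := by
  refine le_antisymm (rnorm_smul_le r a A) ?_
  rcases eq_or_ne a 0 with rfl | ha
  · simpa using rnorm_nonneg _ _
  · have h := rnorm_smul_le r a⁻¹ (a • A)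
    rw [smul_smul, inv_mul_cancel₀ ha, one_smul, abs_inv] at h
    have h' : 0 < |a| := abs_pos.2 ha
    rwa [inv_mul_eq_div, le_div_iff₀ h', mul_comm] at h

lemma rnorm_mono {r s : ℕ} (h : r ≤ s) (A : Pointed E V) : rnorm s A ≤ rnorm r A := by
  have := le_mul_rnorm (r := r) (rnorm s) (rnorm_zero s).le (rnorm_add_le s) zero_le_one
    (fun U hU p α => by simpa using rnorm_diffs_le (hU.trans h) p α) A
  simpa using this

end General

/-- The space of pointed chains, equipped with the `r`-norm. -/
def NormedPointed (E V : Type) [NormedAddCommGroup V] (_r : ℕ) : Type := Pointed E V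

section Chains

variable (E V : Type) [NormedAddCommGroup E] [NormedSpace ℝ E]
  [NormedAddCommGroup V] [NormedSpace ℝ V] (r : ℕ)

instance : AddCommGroup (NormedPointed E V r) := inferInstanceAs (AddCommGroup (E →₀ V))
instance : Module ℝ (NormedPointed E V r) := inferInstanceAs (Module ℝ (E →₀ V))
instance : Norm (NormedPointed E V r) := ⟨fun A => rnorm r (A : Pointed E V)⟩

lemma normedPointed_core : SeminormedSpace.Core ℝ (NormedPointed E V r) where
  norm_nonneg A := rnorm_nonneg r (A : Pointed E V)
  norm_smul a A := rnorm_smul r a (A : Pointed E V)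
  norm_triangle A B := rnorm_add_le r (A : Pointed E V) B

instance : SeminormedAddCommGroup (NormedPointed E V r) :=
  SeminormedAddCommGroup.ofCore (normedPointed_core E V r)

instance : NormedSpace ℝ (NormedPointed E V r) where
  norm_smul_le a A := rnorm_smul_le r a (A : Pointed E V)

/-- The Banach space of differential chains of order `r` in `E` with coefficients in `V`: the
completion of the pointed chains in the `r`-norm. -/
abbrev Chain : Type := UniformSpace.Completion (NormedPointed E V r)

end Chains

section Operators

variable {E V W F : Type} [NormedAddCommGroup E] [NormedSpace ℝ E]
  [NormedAddCommGroup V] [NormedSpace ℝ V] [NormedAddCommGroup W] [NormedSpace ℝ W]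
  [NormedAddCommGroup F] [NormedSpace ℝ F]

/-- A pointed chain, regarded as a differential chain of order `r`. -/
def ofPointed (r : ℕ) : Pointed E V →ₗ[ℝ] Chain E V r :=
  (UniformSpace.Completion.toComplₗᵢ (𝕜 := ℝ) (E := NormedPointed E V r)).toLinearMap

lemma norm_ofPointed (r : ℕ) (A : Pointed E V) : ‖ofPointed r A‖ = rnorm r A :=
  UniformSpace.Completion.norm_coe (E := NormedPointed E V r) A

lemma denseRange_ofPointed (r : ℕ) : DenseRange (ofPointed (E := E) (V := V) r) :=
  UniformSpace.Completion.denseRange_coe (α := NormedPointed E V r)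

/-- The continuous extension to chains of order `r` of a linear map on pointed chains. The extension
exists as soon as the map is bounded in the `r`-norm; every use below comes with a proof of this. -/
def extend [CompleteSpace F] {r : ℕ} (f : Pointed E V →ₗ[ℝ] F)
    (_hf : ∃ C, ∀ A, ‖f A‖ ≤ C * rnorm r A) : Chain E V r →L[ℝ] F :=
  f.extendOfNorm (ofPointed r)

lemma extend_ofPointed [CompleteSpace F] {r : ℕ} (f : Pointed E V →ₗ[ℝ] F)
    (hf : ∃ C, ∀ A, ‖f A‖ ≤ C * rnorm r A) (A : Pointed E V) :
    extend f hf (ofPointed r A) = f A :=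
  LinearMap.extendOfNorm_eq (denseRange_ofPointed r) (by simpa only [norm_ofPointed] using hf) A

/-- The canonical map from chains of order `r` to chains of order `s ≥ r`. -/
def incl {r s : ℕ} (h : r ≤ s) : Chain E V r →L[ℝ] Chain E V s :=
  extend (ofPointed s) ⟨1, fun A => by
    rw [norm_ofPointed, one_mul]; exact rnorm_mono h A⟩

/-! Operators on coefficients. -/

/-- The map `∑ (pᵢ; αᵢ) ↦ ∑ (pᵢ; T αᵢ)` on pointed chains. -/
def mapCoeffPointed (T : V →L[ℝ] W) : Pointed E V →ₗ[ℝ] Pointed E W :=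
  Finsupp.mapRange.linearMap T.toLinearMap

lemma mapCoeffPointed_elt (T : V →L[ℝ] W) (p : E) (α : V) :
    mapCoeffPointed T (elt p α) = elt p (T α) := by
  simp [mapCoeffPointed]

lemma diff_elt (u p : E) (α : V) : diff u (elt p α) = elt (p + u) α - elt p α := by
  simp [diff, translate]

lemma mapCoeffPointed_diffs (T : V →L[ℝ] W) (U : List E) (A : Pointed E V) :
    mapCoeffPointed T (diffs U A) = diffs U (mapCoeffPointed T A) := by
  induction U with
  | nil => rfl
  | cons u U ih =>
    have h : ∀ B : Pointed E V, mapCoeffPointed T (diff u B) = diff u (mapCoeffPointed T B) := by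
      intro B
      induction B using Finsupp.induction_linear with
      | zero => simp
      | add f g hf hg => simp only [map_add, hf, hg]
      | single p α =>
        rw [diff_elt, map_sub, mapCoeffPointed_elt, mapCoeffPointed_elt, diff_elt]
    simp only [diffs, LinearMap.comp_apply, h, ih]

lemma size_map_le (T : V →L[ℝ] W) (U : List E) (α : V) : size U (T α) ≤ ‖T‖ * size U α := by
  have h : 0 ≤ (U.map fun u => ‖u‖).prod := by
    refine List.prod_nonneg ?_
    intro a ha
    obtain ⟨u, -, rfl⟩ := List.mem_map.1 ha
    exact norm_nonneg u
  unfold size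
  calc _ ≤ (U.map fun u => ‖u‖).prod * (‖T‖ * ‖α‖) :=
        mul_le_mul_of_nonneg_left (T.le_opNorm α) h
    _ = _ := by ring

lemma rnorm_mapCoeffPointed_le (T : V →L[ℝ] W) (r : ℕ) (A : Pointed E V) :
    rnorm r (mapCoeffPointed T A) ≤ ‖T‖ * rnorm r A := by
  refine le_mul_rnorm (fun A => rnorm r (mapCoeffPointed T A)) ?_ ?_ (norm_nonneg T) ?_ A
  · simp [rnorm_zero]
  · intro A B; simpa using rnorm_add_le r (mapCoeffPointed T A) (mapCoeffPointed T B)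
  · intro U hU p α
    rw [mapCoeffPointed_diffs, mapCoeffPointed_elt]
    exact (rnorm_diffs_le hU p _).trans (size_map_le T U α)

/-- The map `(p; α) ↦ (p; T α)`, extended to chains of order `r`. -/
def mapCoeff (T : V →L[ℝ] W) (r : ℕ) : Chain E V r →L[ℝ] Chain E W r :=
  extend ((ofPointed r).comp (mapCoeffPointed T)) ⟨‖T‖, fun A => by
    rw [LinearMap.comp_apply, norm_ofPointed]; exact rnorm_mapCoeffPointed_le T r A⟩

/-! The prederivative. -/

lemma rnorm_diff_le (u : E) (r : ℕ) (A : Pointed E V) :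
    rnorm (r + 1) (diff u A) ≤ ‖u‖ * rnorm r A := by
  refine le_mul_rnorm (fun A => rnorm (r + 1) (diff u A)) ?_ ?_ (norm_nonneg u) ?_ A
  · simp [rnorm_zero]
  · intro A B; simpa using rnorm_add_le (r + 1) (diff u A) (diff u B)
  · intro U hU p α
    have := rnorm_diffs_le (r := r + 1) (U := u :: U) (by simpa using hU) p α
    simpa [diffs, size, mul_assoc] using this

lemma diff_add (u v : E) (A : Pointed E V) :
    diff (u + v) A = diff u A + diff v A + diff u (diff v A) := by
  induction A using Finsupp.induction_linear with
  | zero => simp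
  | add f g hf hg => simp only [map_add, hf, hg]; abel
  | single p α =>
    simp only [diff_elt, map_sub]
    rw [show p + v + u = p + (u + v) by abel]
    abel

/-- A map from the reals to a Banach space that is Lipschitz at `0` and additive up to a quadratic
error has a derivative at `0`. -/
lemma exists_tendsto_of_quasiadditive {X : Type*} [NormedAddCommGroup X] [NormedSpace ℝ X]
    [CompleteSpace X] (D : ℝ → X) (L M : ℝ) (hL : ∀ t, ‖D t‖ ≤ L * |t|)
    (hM : ∀ t s, ‖D (t + s) - D t - D s‖ ≤ M * (|t| * |s|)) :
    ∃ y, Tendsto (fun t : ℝ => t⁻¹ • D t) (𝓝[≠] 0) (𝓝 y) := by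
  have hM0 : 0 ≤ M := by simpa using (norm_nonneg _).trans (hM 1 1)
  set g : ℕ → ℝ → X := fun n t => (2 : ℝ) ^ n • D (t / 2 ^ n) with hg
  have hstep : ∀ t n, dist (g n t) (g (n + 1) t) ≤ M * t ^ 2 / 2 / 2 / 2 ^ n := by
    intro t n
    have h := hM (t / 2 ^ (n + 1)) (t / 2 ^ (n + 1))
    rw [show t / 2 ^ (n + 1) + t / 2 ^ (n + 1) = t / 2 ^ n by rw [pow_succ]; field_simp; ring,
      ← abs_mul, abs_mul_self] at h
    have e : g n t - g (n + 1) t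
        = (2 : ℝ) ^ n • (D (t / 2 ^ n) - D (t / 2 ^ (n + 1)) - D (t / 2 ^ (n + 1))) := by
      simp only [hg, pow_succ (2 : ℝ) n, smul_sub, mul_smul, two_smul, smul_add]
      abel
    rw [dist_eq_norm, e, norm_smul, Real.norm_of_nonneg (by positivity)]
    calc _ ≤ 2 ^ n * (M * (t / 2 ^ (n + 1) * (t / 2 ^ (n + 1)))) :=
          mul_le_mul_of_nonneg_left h (by positivity)
      _ = _ := by rw [pow_succ]; field_simp; try ring
  have hcau : ∀ t, ∃ y, Tendsto (fun n => g n t) atTop (𝓝 y) := fun t =>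
    cauchySeq_tendsto_of_complete (cauchySeq_of_le_geometric_two (hstep t))
  choose G hG using hcau
  have hGD : ∀ t, ‖G t - D t‖ ≤ M * t ^ 2 / 2 := by
    intro t
    have := dist_le_of_le_geometric_two_of_tendsto₀ (hstep t) (hG t)
    rw [dist_comm, dist_eq_norm] at this
    simpa [hg] using this
  have hadd : ∀ t s, G (t + s) = G t + G s := by
    intro t s
    have h1 : Tendsto (fun n => g n (t + s) - g n t - g n s) atTop (𝓝 (G (t + s) - G t - G s)) :=
      ((hG _).sub (hG _)).sub (hG _)
    have h2 : Tendsto (fun n => g n (t + s) - g n t - g n s) atTop (𝓝 0) := by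
      refine squeeze_zero_norm (a := fun n => M * (|t| * |s|) * (1 / 2) ^ n) (fun n => ?_) ?_
      · have h := hM (t / 2 ^ n) (s / 2 ^ n)
        rw [← add_div] at h
        simp only [hg, ← smul_sub]
        rw [norm_smul, Real.norm_of_nonneg (by positivity)]
        refine (mul_le_mul_of_nonneg_left h (by positivity)).trans (le_of_eq ?_)
        rw [abs_div, abs_div, abs_of_pos (show (0 : ℝ) < 2 ^ n by positivity), one_div, inv_pow]
        field_simp
      · simpa using (tendsto_pow_atTop_nhds_zero_of_lt_one (r := (1 / 2 : ℝ)) (by norm_num)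
          (by norm_num)).const_mul (M * (|t| * |s|))
    have h3 := tendsto_nhds_unique h1 h2
    rw [sub_sub, sub_eq_zero] at h3
    exact h3
  have hGL : ∀ t, ‖G t‖ ≤ L * |t| := by
    intro t
    refine le_of_tendsto (hG t).norm (Eventually.of_forall fun n => ?_)
    simp only [hg]
    rw [norm_smul, Real.norm_of_nonneg (by positivity)]
    refine (mul_le_mul_of_nonneg_left (hL _) (by positivity)).trans (le_of_eq ?_)
    rw [abs_div, abs_of_pos (show (0 : ℝ) < 2 ^ n by positivity)]
    field_simp
  let Gh : ℝ →+ X := AddMonoidHom.mk' G hadd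
  have hcont : Continuous Gh :=
    AddMonoidHomClass.continuous_of_bound Gh L (fun t => by simpa [Gh] using hGL t)
  have hlin : ∀ t, G t = t • G 1 := by
    intro t
    have := map_real_smul Gh hcont t 1
    simpa [Gh] using this
  refine ⟨G 1, ?_⟩
  rw [tendsto_iff_norm_sub_tendsto_zero]
  refine squeeze_zero' (g := fun t => M * |t| / 2) (Eventually.of_forall fun _ => norm_nonneg _)
    ?_ ?_
  · filter_upwards [self_mem_nhdsWithin] with t ht
    have ht' : t ≠ 0 := ht
    have e : t⁻¹ • D t - G 1 = t⁻¹ • (D t - G t) := by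
      rw [smul_sub, hlin t, smul_smul, inv_mul_cancel₀ ht', one_smul]
    rw [e, norm_smul, norm_sub_rev, norm_inv, Real.norm_eq_abs]
    have h0 : 0 < |t| := abs_pos.2 ht'
    rw [inv_mul_le_iff₀ h0]
    refine (hGD t).trans (le_of_eq ?_)
    rw [← sq_abs]; ring
  · have : Tendsto (fun t : ℝ => M * |t| / 2) (𝓝 0) (𝓝 (M * |(0 : ℝ)| / 2)) := by
      refine Continuous.tendsto ?_ 0
      fun_prop
    simpa using this.mono_left nhdsWithin_le_nhds

/-- The difference quotient `Δ_{tv} (A / t)`. -/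
def diffQuot (v : E) (t : ℝ) (A : Pointed E V) : Pointed E V := diff (t • v) (t⁻¹ • A)

lemma exists_tendsto_diffQuot (v : E) {r : ℕ} (hr : 1 ≤ r) (A : Pointed E V) :
    ∃ y, Tendsto (fun t : ℝ => ofPointed (r + 1) (diffQuot v t A)) (𝓝[≠] 0) (𝓝 y) := by
  obtain ⟨n, rfl⟩ : ∃ n, r = n + 1 := ⟨r - 1, by omega⟩
  have := exists_tendsto_of_quasiadditive (fun t : ℝ => ofPointed (n + 1 + 1) (diff (t • v) A))
    (‖v‖ * rnorm (n + 1) A) (‖v‖ * ‖v‖ * rnorm n A) ?_ ?_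
  · simpa only [diffQuot, map_smul] using this
  · intro t
    rw [norm_ofPointed]
    refine (rnorm_diff_le _ _ _).trans (le_of_eq ?_)
    rw [norm_smul, Real.norm_eq_abs]; ring
  · intro t s
    rw [add_smul, diff_add, ← map_sub, ← map_sub, norm_ofPointed]
    rw [show ∀ a b c : Pointed E V, a + b + c - a - b = c by intros; abel]
    refine (rnorm_diff_le _ _ _).trans ?_
    refine (mul_le_mul_of_nonneg_left (rnorm_diff_le _ _ _) (norm_nonneg _)).trans (le_of_eq ?_)
    rw [norm_smul, norm_smul, Real.norm_eq_abs, Real.norm_eq_abs]; ring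

/-- The limit of `Δ_{tv} (A / t)` as `t → 0`, in the chains of order `r + 1`. -/
def prederivPointedFun (v : E) {r : ℕ} (hr : 1 ≤ r) (A : Pointed E V) : Chain E V (r + 1) :=
  (exists_tendsto_diffQuot v hr A).choose

lemma tendsto_prederivPointedFun (v : E) {r : ℕ} (hr : 1 ≤ r) (A : Pointed E V) :
    Tendsto (fun t : ℝ => ofPointed (r + 1) (diffQuot v t A)) (𝓝[≠] 0)
      (𝓝 (prederivPointedFun v hr A)) :=
  (exists_tendsto_diffQuot v hr A).choose_spec

/-- The prederivative `P_v` on pointed chains. -/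
def prederivPointed (v : E) {r : ℕ} (hr : 1 ≤ r) : Pointed E V →ₗ[ℝ] Chain E V (r + 1) where
  toFun := prederivPointedFun v hr
  map_add' A B := by
    refine tendsto_nhds_unique (tendsto_prederivPointedFun v hr (A + B)) ?_
    simpa only [diffQuot, smul_add, map_add] using
      (tendsto_prederivPointedFun v hr A).add (tendsto_prederivPointedFun v hr B)
  map_smul' a A := by
    refine tendsto_nhds_unique (tendsto_prederivPointedFun v hr (a • A)) ?_
    have h := (tendsto_prederivPointedFun v hr A).const_smul a
    refine h.congr fun t => ?_
    simp only [diffQuot, map_smul]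
    rw [smul_comm]

lemma norm_prederivPointed_le (v : E) {r : ℕ} (hr : 1 ≤ r) (A : Pointed E V) :
    ‖prederivPointed v hr A‖ ≤ ‖v‖ * rnorm r A := by
  refine le_of_tendsto (tendsto_prederivPointedFun v hr A).norm ?_
  filter_upwards [self_mem_nhdsWithin] with t ht
  have ht' : 0 < |t| := abs_pos.2 ht
  rw [norm_ofPointed, diffQuot]
  refine (rnorm_diff_le _ _ _).trans (le_of_eq ?_)
  rw [norm_smul, rnorm_smul, Real.norm_eq_abs, abs_inv]
  field_simp

/-- The prederivative `P_v`, from chains of order `r ≥ 1` to chains of order `r + 1`. -/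
def prederiv (v : E) {r : ℕ} (hr : 1 ≤ r) : Chain E V r →L[ℝ] Chain E V (r + 1) :=
  extend (prederivPointed v hr) ⟨‖v‖, norm_prederivPointed_le v hr⟩

/-! Forms and the integral. -/

/-- The value `∑ ω_{pᵢ} (αᵢ)` of a form on the pointed chain `∑ (pᵢ; αᵢ)`. -/
def evalForm (ω : E → V →L[ℝ] F) : Pointed E V →ₗ[ℝ] F :=
  Finsupp.lsum ℝ fun p => (ω p).toLinearMap

variable (E V F) in
/-- The forms of class `B^r` with values in `F`: the form is bounded by a multiple of the size on
all difference chains of order at most `r`, i.e. its norm `‖ω‖_{B^r}` is finite. -/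
structure Form (r : ℕ) where
  /-- the underlying field of linear functionals on the coefficients -/
  toFun : E → V →L[ℝ] F
  bounded' : ∃ C, ∀ U : List E, U.length ≤ r → ∀ (p : E) (α : V),
    ‖evalForm toFun (diffs U (elt p α))‖ ≤ C * size U α

lemma Form.bounded {r : ℕ} (ω : Form E V F r) :
    ∃ C, 0 ≤ C ∧ ∀ U : List E, U.length ≤ r → ∀ (p : E) (α : V),
      ‖evalForm ω.toFun (diffs U (elt p α))‖ ≤ C * size U α := by
  obtain ⟨C, hC⟩ := ω.bounded'
  exact ⟨max C 0, le_max_right _ _, fun U hU p α => (hC U hU p α).trans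
    (mul_le_mul_of_nonneg_right (le_max_left _ _) (size_nonneg _ _))⟩

lemma Form.norm_eval_le {r : ℕ} (ω : Form E V F r) :
    ∃ C, ∀ A, ‖evalForm ω.toFun A‖ ≤ C * rnorm r A := by
  obtain ⟨C, hC0, hC⟩ := ω.bounded
  refine ⟨C, le_mul_rnorm (fun A => ‖evalForm ω.toFun A‖) (by simp) (fun A B => ?_) hC0 hC⟩
  simpa using norm_add_le (evalForm ω.toFun A) (evalForm ω.toFun B)

/-- The integral `∫_J ω` of a form of class `B^r` over a chain of order `r`: the continuous extension
of the evaluation on pointed chains. -/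
def integral [CompleteSpace F] {r : ℕ} (J : Chain E V r) (ω : Form E V F r) : F :=
  extend (evalForm ω.toFun) ω.norm_eval_le J

/-! Multiplication by a function. -/

/-- Functions of class `B^r`, i.e. `0`-forms; the value at `p` is `f.val p`. -/
abbrev Func (E : Type) [NormedAddCommGroup E] [NormedSpace ℝ E] (r : ℕ) : Type := Form E ℝ ℝ r

/-- The value at `p` of the `0`-form `f`. -/
def Func.val {r : ℕ} (f : Func E r) (p : E) : ℝ := f.toFun p 1

/-- The map `∑ (pᵢ; αᵢ) ↦ ∑ (pᵢ; f(pᵢ) αᵢ)` on pointed chains. -/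
def mulPointed (f : E → ℝ) : Pointed E V →ₗ[ℝ] Pointed E V :=
  Finsupp.lsum ℝ fun p => (Finsupp.lsingle p).comp (f p • LinearMap.id)

lemma mulPointed_elt (f : E → ℝ) (p : E) (α : V) :
    mulPointed f (elt p α) = elt p (f p • α) := by
  simp [mulPointed]

/-- The value of a real function on a pointed `0`-chain. -/
def evalFun (f : E → ℝ) : Pointed E ℝ →ₗ[ℝ] ℝ := Finsupp.lsum ℝ fun p => f p • LinearMap.id

lemma evalFun_elt (f : E → ℝ) (p : E) (a : ℝ) : evalFun f (elt p a) = f p * a := by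
  simp [evalFun]

lemma mulPointed_diff (f : E → ℝ) (u : E) (A : Pointed E V) :
    mulPointed f (diff u A) = diff u (mulPointed (fun p => f (p + u)) A)
      + mulPointed (fun p => f (p + u) - f p) A := by
  induction A using Finsupp.induction_linear with
  | zero => simp
  | add f g hf hg => simp only [map_add, hf, hg]; abel
  | single p α =>
    simp only [diff_elt, map_sub, mulPointed_elt, sub_smul, Finsupp.single_sub]
    abel

lemma evalFun_shift (f : E → ℝ) (u : E) (A : Pointed E ℝ) :
    evalFun (fun p => f (p + u)) A = evalFun f (translate u A) := by
  induction A using Finsupp.induction_linear with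
  | zero => simp
  | add f g hf hg => simp only [map_add, hf, hg]
  | single p α => simp [evalFun_elt, translate]

lemma evalFun_diff (f : E → ℝ) (u : E) (A : Pointed E ℝ) :
    evalFun (fun p => f (p + u) - f p) A = evalFun f (diff u A) := by
  induction A using Finsupp.induction_linear with
  | zero => simp
  | add f g hf hg => simp only [map_add, hf, hg]
  | single p α => rw [diff_elt, map_sub, evalFun_elt, evalFun_elt, evalFun_elt]; ring

lemma translate_diffs (u : E) (U : List E) (p : E) (α : V) :
    translate u (diffs U (elt p α)) = diffs U (elt (p + u) α) := by
  induction U generalizing p with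
  | nil => simp [diffs, translate]
  | cons v U ih =>
    have h : ∀ A : Pointed E V, translate u (diff v A) = diff v (translate u A) := by
      intro A
      induction A using Finsupp.induction_linear with
      | zero => simp
      | add f g hf hg => simp only [map_add, hf, hg]
      | single p α =>
        simp only [diff_elt, map_sub, translate, Finsupp.lmapDomain_apply, Finsupp.mapDomain_single]
        rw [add_right_comm]
    simp only [diffs, LinearMap.comp_apply, h, ih]

lemma diff_diffs_comm (u : E) (U : List E) (A : Pointed E V) :
    diff u (diffs U A) = diffs U (diff u A) := by
  induction A using Finsupp.induction_linear with
  | zero => simp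
  | add f g hf hg => simp only [map_add, hf, hg]
  | single p α =>
    rw [diff_elt, map_sub, ← translate_diffs]
    rfl

lemma rnorm_mulPointed_diffs_le (U : List E) (f : E → ℝ) (C : ℝ)
    (hf : ∀ U' : List E, U'.length ≤ U.length → ∀ p : E,
      |evalFun f (diffs U' (elt p 1))| ≤ C * size U' (1 : ℝ)) (p : E) (α : V) :
    rnorm U.length (mulPointed f (diffs U (elt p α))) ≤ 2 ^ U.length * C * size U α := by
  induction U generalizing f C with
  | nil =>
    have h := hf [] le_rfl p
    simp only [diffs, LinearMap.id_apply, evalFun_elt, mul_one, size, List.map_nil, List.prod_nil,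
      norm_one] at h
    simp only [diffs, LinearMap.id_apply, mulPointed_elt, List.length_nil, pow_zero, one_mul, size,
      List.map_nil, List.prod_nil]
    refine (rnorm_diffs_le (U := []) (r := 0) le_rfl p (f p • α)).trans ?_
    simp only [size, List.map_nil, List.prod_nil, one_mul, norm_smul, Real.norm_eq_abs]
    exact mul_le_mul_of_nonneg_right h (norm_nonneg _)
  | cons u U ih =>
    have h1 := ih (fun p => f (p + u)) C (fun U' hU' q => by
      rw [evalFun_shift, translate_diffs]
      exact hf U' (hU'.trans (by simp)) (q + u))
    have h2 := ih (fun p => f (p + u) - f p) (C * ‖u‖) (fun U' hU' q => by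
      rw [evalFun_diff]
      have := hf (u :: U') (by simpa using hU') q
      refine this.trans (le_of_eq ?_)
      simp only [size, List.map_cons, List.prod_cons]; ring)
    simp only [diffs, LinearMap.comp_apply, mulPointed_diff, List.length_cons]
    refine (rnorm_add_le _ _ _).trans ?_
    have h3 := (rnorm_diff_le u U.length _).trans (mul_le_mul_of_nonneg_left h1 (norm_nonneg u))
    have h4 := (rnorm_mono (Nat.le_succ U.length) _).trans h2
    refine (add_le_add h3 h4).trans (le_of_eq ?_)
    simp only [size, List.map_cons, List.prod_cons, pow_succ]; ring

lemma evalForm_eq_evalFun {r : ℕ} (f : Func E r) (A : Pointed E ℝ) :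
    evalForm f.toFun A = evalFun f.val A := by
  induction A using Finsupp.induction_linear with
  | zero => simp
  | add f g hf hg => simp only [map_add, hf, hg]
  | single p a =>
    rw [evalFun_elt, Func.val]
    have : f.toFun p a = f.toFun p 1 * a := by
      have := (f.toFun p).map_smul a 1
      simp only [smul_eq_mul, mul_one] at this
      rw [this, mul_comm]
    simpa [evalForm] using this

lemma rnorm_mulPointed_le {r : ℕ} (f : Func E r) :
    ∃ C, ∀ A : Pointed E V, rnorm r (mulPointed f.val A) ≤ C * rnorm r A := by
  obtain ⟨C, hC0, hC⟩ := f.bounded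
  refine ⟨2 ^ r * C, le_mul_rnorm (fun A : Pointed E V => rnorm r (mulPointed f.val A)) ?_ ?_
    (by positivity) ?_⟩
  · simp [rnorm_zero]
  · intro A B; simpa using rnorm_add_le r (mulPointed f.val A) (mulPointed f.val B)
  · intro U hU p α
    refine (rnorm_mono hU _).trans ((rnorm_mulPointed_diffs_le U f.val C ?_ p α).trans ?_)
    · intro U' hU' q
      rw [← evalForm_eq_evalFun, ← Real.norm_eq_abs]
      exact hC U' (hU'.trans hU) q 1
    · refine mul_le_mul_of_nonneg_right ?_ (size_nonneg _ _)
      exact mul_le_mul_of_nonneg_right (pow_le_pow_right₀ (by norm_num) hU) hC0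

/-- Multiplication `m_f` of chains of order `r` by a function `f` of class `B^r`. -/
def mul {r : ℕ} (f : Func E r) : Chain E V r →L[ℝ] Chain E V r :=
  extend ((ofPointed r).comp (mulPointed f.val)) (by
    obtain ⟨C, hC⟩ := rnorm_mulPointed_le (V := V) f
    refine ⟨C, fun A => ?_⟩
    rw [LinearMap.comp_apply, norm_ofPointed]
    exact hC A)

/-! Support, mass, restriction. -/

/-- The closed set `X` supports `J`: for every nonempty open `O ⊇ X` the chain `J` is a limit of
pointed chains in `O`. -/
def IsSupportedBy {r : ℕ} (J : Chain E V r) (X : Set E) : Prop :=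
  ∀ O : Set E, IsOpen O → O.Nonempty → X ⊆ O →
    ∃ A : ℕ → Pointed E V, (∀ i, ((A i).support : Set E) ⊆ O) ∧
      Tendsto (fun i => ofPointed r (A i)) atTop (𝓝 J)

/-- The support of a chain: the intersection of all closed sets that support it. -/
def supp {r : ℕ} (J : Chain E V r) : Set E :=
  ⋂₀ {X | IsClosed X ∧ IsSupportedBy J X}

/-- The mass of a chain: the infimum of `liminf ‖Aᵢ‖_{B^0}` over all sequences of pointed chains
`Aᵢ` that converge to it. -/
def mass {r : ℕ} (K : Chain E V r) : ENNReal :=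
  ⨅ (A : ℕ → Pointed E V) (_ : Tendsto (fun i => ofPointed r (A i)) atTop (𝓝 K)),
    liminf (fun i => ENNReal.ofReal (rnorm 0 (A i))) atTop

/-- `L` is the restriction of `K` to the open set `O`: the chains `m_{fᵢ} K` converge to `L` for all
sequences of functions `0 ≤ fᵢ ≤ 1` of class `B^r` that vanish off `O` and converge pointwise to `1`
on `O`, i.e. that converge from below to the indicator function of `O`. Such sequences exist, so that
`L` is unique. -/
def IsRestriction {r : ℕ} (K : Chain E V r) (O : Set E) (L : Chain E V r) : Prop :=
  ∀ f : ℕ → Func E r, (∀ i p, 0 ≤ (f i).val p ∧ (f i).val p ≤ 1) →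
    (∀ i, ∀ p ∉ O, (f i).val p = 0) →
    (∀ p ∈ O, Tendsto (fun i => (f i).val p) atTop (𝓝 1)) →
    Tendsto (fun i => mul (f i) K) atTop (𝓝 L)

/-- `∫_J ω = c` for a form `ω` that need not be of class `B^r` away from `J`: some form of class `B^r`
on the whole space agrees with `ω` on a neighbourhood of the support of `J`, and the integral over `J`
of every such form is `c`. -/
def HasIntegral [CompleteSpace F] {r : ℕ} (J : Chain E V r) (ω : E → V →L[ℝ] F) (c : F) : Prop :=
  (∃ η : Form E V F r, ∃ O : Set E, IsOpen O ∧ supp J ⊆ O ∧ ∀ w ∈ O, η.toFun w = ω w) ∧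
  ∀ η : Form E V F r, (∃ O : Set E, IsOpen O ∧ supp J ⊆ O ∧ ∀ w ∈ O, η.toFun w = ω w) →
    integral J η = c

end Operators

/-! Chains in the plane, which is identified with `ℂ`. The spaces of `0`-, `1`- and `2`-vectors of
the plane are `ℝ`, `ℂ` and `ℝ · e₁ ∧ e₂ = ℝ`, where `e₁ = 1` and `e₂ = I`. Every `k`-vector of the
plane is simple, and its mass is the absolute value in each case. -/

/-- Differential `0`-chains of order `r` in the plane. -/
abbrev Chain0 (r : ℕ) : Type := Chain ℂ ℝ r

/-- Differential `1`-chains of order `r` in the plane. -/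
abbrev Chain1 (r : ℕ) : Type := Chain ℂ ℂ r

/-- Differential `2`-chains of order `r` in the plane; `(p; a)` stands for `(p; a e₁ ∧ e₂)`. -/
abbrev Chain2 (r : ℕ) : Type := Chain ℂ ℝ r

/-- The retraction `w ↦ ⟨v, w⟩` from `1`-vectors to `0`-vectors. -/
def retract1 (v : ℂ) : ℂ →L[ℝ] ℝ := innerSL ℝ v

/-- The retraction `a e₁ ∧ e₂ ↦ a (⟨v, e₁⟩ e₂ - ⟨v, e₂⟩ e₁)` from `2`-vectors to `1`-vectors. -/
def retract2 (v : ℂ) : ℝ →L[ℝ] ℂ :=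
  (ContinuousLinearMap.id ℝ ℝ).smulRight (v.re • Complex.I - v.im • (1 : ℂ))

/-- The boundary `∂ = P_{e₁} E_{e₁}† + P_{e₂} E_{e₂}†` of `1`-chains. -/
def boundary1 {r : ℕ} (hr : 1 ≤ r) : Chain1 r →L[ℝ] Chain0 (r + 1) :=
  (prederiv (1 : ℂ) hr).comp (mapCoeff (retract1 1) r) +
    (prederiv Complex.I hr).comp (mapCoeff (retract1 Complex.I) r)

/-- The boundary `∂ = P_{e₁} E_{e₁}† + P_{e₂} E_{e₂}†` of `2`-chains. -/
def boundary2 {r : ℕ} (hr : 1 ≤ r) : Chain2 r →L[ℝ] Chain1 (r + 1) :=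
  (prederiv (1 : ℂ) hr).comp (mapCoeff (retract2 1) r) +
    (prederiv Complex.I hr).comp (mapCoeff (retract2 Complex.I) r)

/-- `∂K = J` for a `2`-chain `K` of order `s` and a `1`-chain `J` of order `r`, as an equality in the
inductive limit of the spaces of chains of finite order. -/
def IsBoundary {r s : ℕ} (K : Chain2 s) (J : Chain1 r) : Prop :=
  ∃ (n : ℕ) (hn : 1 ≤ n) (hs : s ≤ n) (hr : r ≤ n + 1),
    boundary2 hn (incl hs K) = incl hr J

/-- The (complex-valued) `1`-form `dw / (w - z)`. -/
def cauchyForm (z : ℂ) (w : ℂ) : ℂ →L[ℝ] ℂ := (w - z)⁻¹ • ContinuousLinearMap.id ℝ ℂ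

/-- The winding number `Ind_J(z) = (1 / 2πi) ∫_J dw / (w - z)` exists and is equal to `c`. -/
def HasWindingNumber {r : ℕ} (J : Chain1 r) (z : ℂ) (c : ℂ) : Prop :=
  ∃ I : ℂ, HasIntegral J (cauchyForm z) I ∧ c = 1 / (2 * Real.pi * Complex.I) * I

/-- The volume form `dv` of the plane. -/
def volumeForm (r : ℕ) : Form ℂ ℝ ℝ r where
  toFun _ := ContinuousLinearMap.id ℝ ℝ
  bounded' := by
    have h : ∀ A : Pointed ℂ ℝ, ∀ u : ℂ,
        evalForm (fun _ => ContinuousLinearMap.id ℝ ℝ) (diff u A) = 0 := by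
      intro A u
      induction A using Finsupp.induction_linear with
      | zero => simp
      | add f g hf hg => simp only [map_add, hf, hg, add_zero]
      | single p a => rw [diff_elt, map_sub]; simp [evalForm]
    refine ⟨1, fun U _ p a => ?_⟩
    cases U with
    | nil => simp [diffs, evalForm, size]
    | cons u U =>
      simp only [diffs, LinearMap.comp_apply, h, norm_zero, one_mul]
      exact size_nonneg _ _

/-- The signed density of the `2`-chain `K` at `x` exists and is equal to `d`: the restriction of `K`
to the ball of radius `ε` about `x` exists for small `ε > 0`, and its integral against `dv`, divided
by the area of the ball, tends to `d` as `ε → 0`. -/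
def HasSignedDensity {s : ℕ} (K : Chain2 s) (x : ℂ) (d : ℝ) : Prop :=
  ∃ L : ℝ → Chain2 s, (∀ᶠ ε in 𝓝[>] 0, IsRestriction K (Metric.ball x ε) (L ε)) ∧
    Tendsto (fun ε => 1 / volume.real (Metric.ball x ε) * integral (L ε) (volumeForm s))
      (𝓝[>] 0) (𝓝 d)

end DiffChain

end

/-! A chain is studied as a distribution, through its pairings with forms. Since pointed chains are
dense, `pairing` has three properties. It transposes the operators on chains to operators on forms,
which gives Stokes' formula `IsBoundary.pairing_eq`. It is continuous under pointwise convergence of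
forms with uniformly bounded differences (`tendsto_pairing`), the analogue of bounded convergence.
By Hahn–Banach it separates chains (`eq_zero_of_pairing_eq_zero`).

The core is a constancy theorem, `IsCycleOn.exists_const`. Off the support of J, Stokes' formula
shows that K annihilates all directional derivatives of test functions, so K is invariant under
small translations (`IsCycleOn.pairing_translate`). Mollification turns this into K = d · Lebesgue
measure on a disc about z. In order 0 a chain is determined by its point masses; Lebesgue measure
has no atoms, so there d = 0.

Both quantities equal d. On small discs m_f K is the chain-valued Bochner integral of d f(p) (p;1),
and dominated convergence gives the restriction and the density (`hasSignedDensity_of_const`). For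
the winding number, the Cauchy form is cut off near z by a radial function θ(|w - z|²); the exterior
derivative is 2i θ'(|w - z|²) dv, of total integral 2πi, so Stokes' formula gives 2πi d
(`hasWindingNumber_of_const`).

Uniqueness concerns a 2-chain without boundary in the whole plane. It is a multiple of Lebesgue
measure on every disc, and it takes the same value on all translates of a bump. These translates
tend to zero boundedly, so the value is zero (`IsCycleOn.eq_zero`). -/

noncomputable section

namespace DiffChain

/-! ### Iterated differences of functions and their bounds. -/

section Differences

variable {E F G H : Type} [NormedAddCommGroup E] [NormedSpace ℝ E]
  [NormedAddCommGroup F] [NormedSpace ℝ F] [NormedAddCommGroup G] [NormedSpace ℝ G]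
  [NormedAddCommGroup H] [NormedSpace ℝ H]

/-- The iterated difference of a function along a list of vectors. -/
def fdiffs : List E → (E → G) → E → G
  | [], f => f
  | u :: U, f => fun p => fdiffs U f (p + u) - fdiffs U f p

/-- Differences commute, so the outermost one may be applied to the function first; this drives the
inductions on the order. -/
lemma fdiffs_diff (U : List E) (u : E) (f : E → G) (p : E) :
    fdiffs U (fun q => f (q + u) - f q) p = fdiffs U f (p + u) - fdiffs U f p := by
  induction U generalizing p with
  | nil => rfl
  | cons v U ih => simp only [fdiffs, ih, add_right_comm p v u]; abel

lemma fdiffs_add (U : List E) (f g : E → G) (p : E) :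
    fdiffs U (fun q => f q + g q) p = fdiffs U f p + fdiffs U g p := by
  induction U generalizing p with
  | nil => rfl
  | cons v U ih => simp only [fdiffs, ih]; abel

lemma fdiffs_clm (L : F →L[ℝ] G) (U : List E) (f : E → F) (p : E) :
    fdiffs U (fun q => L (f q)) p = L (fdiffs U f p) := by
  induction U generalizing p with
  | nil => rfl
  | cons v U ih => simp only [fdiffs, ih, map_sub]

lemma fdiffs_comp_add_right (U : List E) (v : E) (f : E → G) (p : E) :
    fdiffs U (fun q => f (q + v)) p = fdiffs U f (p + v) := by
  induction U generalizing p with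
  | nil => rfl
  | cons u U ih => simp only [fdiffs, ih, add_right_comm p u v]

lemma fdiffs_comp_smul (c : ℝ) (U : List E) (f : E → G) (p : E) :
    fdiffs U (fun q => f (c • q)) p = fdiffs (U.map (c • ·)) f (c • p) := by
  induction U generalizing p with
  | nil => rfl
  | cons u U ih => simp only [fdiffs, ih, List.map_cons, smul_add]

lemma prod_norm_nonneg (U : List E) : 0 ≤ (U.map fun u => ‖u‖).prod := by
  refine List.prod_nonneg fun a ha => ?_
  obtain ⟨u, -, rfl⟩ := List.mem_map.1 ha
  exact norm_nonneg u

/-- The iterated differences of `f` of order at most `r` are bounded by `C ‖u₁‖ ⋯ ‖u_j‖`. -/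
def DiffBound (r : ℕ) (C : ℝ) (f : E → G) : Prop :=
  ∀ U : List E, U.length ≤ r → ∀ p, ‖fdiffs U f p‖ ≤ C * (U.map fun u => ‖u‖).prod

namespace DiffBound

variable {r : ℕ} {C D : ℝ} {f : E → G}

lemma norm_le (h : DiffBound r C f) (p : E) : ‖f p‖ ≤ C := by
  simpa [fdiffs] using h [] (Nat.zero_le _) p

lemma nonneg (h : DiffBound r C f) : 0 ≤ C := (norm_nonneg _).trans (h.norm_le 0)

lemma of_norm_le (h : ∀ p, ‖f p‖ ≤ C) : DiffBound 0 C f := by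
  intro U hU p
  obtain rfl : U = [] := List.eq_nil_of_length_eq_zero (Nat.le_zero.1 hU)
  simpa [fdiffs] using h p

lemma mono_order {s : ℕ} (h : DiffBound s C f) (hr : r ≤ s) : DiffBound r C f :=
  fun U hU p => h U (hU.trans hr) p

lemma mono_const (h : DiffBound r C f) (hC : C ≤ D) : DiffBound r D f := fun U hU p =>
  (h U hU p).trans (mul_le_mul_of_nonneg_right hC (prod_norm_nonneg U))

lemma add {g : E → G} (hf : DiffBound r C f) (hg : DiffBound r D g) :
    DiffBound r (C + D) (fun p => f p + g p) := by
  intro U hU p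
  rw [fdiffs_add, add_mul]
  exact (norm_add_le _ _).trans (add_le_add (hf U hU p) (hg U hU p))

lemma clm (L : G →L[ℝ] H) (hf : DiffBound r C f) : DiffBound r (‖L‖ * C) (fun p => L (f p)) := by
  intro U hU p
  rw [fdiffs_clm, mul_assoc]
  exact L.le_opNorm_of_le (hf U hU p)

lemma neg (hf : DiffBound r C f) : DiffBound r C (fun p => - f p) := by
  intro U hU p
  have := fdiffs_clm (-ContinuousLinearMap.id ℝ G) U f p
  simp only [neg_apply, ContinuousLinearMap.id_apply] at this
  rw [this, norm_neg]
  exact hf U hU p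

lemma sub {g : E → G} (hf : DiffBound r C f) (hg : DiffBound r D g) :
    DiffBound r (C + D) (fun p => f p - g p) := by
  simpa only [sub_eq_add_neg] using hf.add hg.neg

lemma comp_add_right (hf : DiffBound r C f) (v : E) : DiffBound r C (fun p => f (p + v)) := by
  intro U hU p
  rw [fdiffs_comp_add_right]
  exact hf U hU _

lemma comp_smul (hf : DiffBound r C f) {c : ℝ} (hc : |c| ≤ 1) :
    DiffBound r C (fun p => f (c • p)) := by
  intro U hU p
  rw [fdiffs_comp_smul]
  refine (hf _ (by simpa using hU) _).trans (mul_le_mul_of_nonneg_left ?_ hf.nonneg)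
  clear hU
  induction U with
  | nil => simp
  | cons u U ih =>
    simp only [List.map_cons, List.prod_cons]
    refine mul_le_mul ?_ ih (prod_norm_nonneg _) (norm_nonneg _)
    rw [norm_smul, Real.norm_eq_abs]
    exact mul_le_of_le_one_left (norm_nonneg _) hc

lemma diff (hf : DiffBound (r + 1) C f) (u : E) :
    DiffBound r (C * ‖u‖) (fun p => f (p + u) - f p) := by
  intro U hU p
  rw [fdiffs_diff]
  simpa [fdiffs, mul_assoc] using hf (u :: U) (by simpa using hU) p

/-- One order of differences is spent on the quotient, and the bound does not depend on t. This
uniformity is what allows t → 0 under a pairing. -/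
lemma diffQuot (hf : DiffBound (r + 1) C f) (v : E) {t : ℝ} (ht : t ≠ 0) :
    DiffBound r (C * ‖v‖) (fun p => t⁻¹ • (f (p + t • v) - f p)) := by
  intro U hU p
  have h := fdiffs_clm (t⁻¹ • ContinuousLinearMap.id ℝ G) U (fun p => f (p + t • v) - f p) p
  simp only [smul_apply, ContinuousLinearMap.id_apply] at h
  rw [h, norm_smul, norm_inv, inv_mul_le_iff₀ (norm_pos_iff.2 ht)]
  refine (hf.diff (t • v) U hU p).trans (le_of_eq ?_)
  rw [norm_smul]; ring

/-- Discrete Leibniz rule Δ_u(a g) = a(· + u) Δ_u g + (Δ_u a) g. Each difference splits a term into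
two, whence the factor 2 ^ r. -/
lemma smul {g : E → G} {a : E → ℝ} (ha : DiffBound r C a) (hg : DiffBound r D g) :
    DiffBound r (2 ^ r * (C * D)) (fun p => a p • g p) := by
  have key : ∀ (U : List E) (a : E → ℝ) (g : E → G) (C D : ℝ), DiffBound U.length C a →
      DiffBound U.length D g → ∀ p, ‖fdiffs U (fun p => a p • g p) p‖
        ≤ 2 ^ U.length * (C * D) * (U.map fun u => ‖u‖).prod := by
    intro U
    induction U with
    | nil =>
      intro a g C D ha hg p
      simp only [fdiffs, List.length_nil, pow_zero, one_mul, List.map_nil, List.prod_nil, mul_one,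
        norm_smul]
      exact mul_le_mul (ha.norm_le p) (hg.norm_le p) (norm_nonneg _) ha.nonneg
    | cons u U ih =>
      intro a g C D ha hg p
      have e : (fun q => a (q + u) • g (q + u) - a q • g q)
          = fun q => a (q + u) • (g (q + u) - g q) + (a (q + u) - a q) • g q := by
        funext q; simp only [smul_sub, sub_smul]; abel
      change ‖fdiffs U _ (p + u) - fdiffs U _ p‖ ≤ _
      rw [← fdiffs_diff, e, fdiffs_add]
      have h1 := ih (fun q => a (q + u)) (fun q => g (q + u) - g q) C (D * ‖u‖)
        ((ha.mono_order (by simp)).comp_add_right u) (DiffBound.diff hg u) p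
      have h2 := ih (fun q => a (q + u) - a q) g (C * ‖u‖) D (DiffBound.diff ha u)
        (hg.mono_order (by simp)) p
      refine (norm_add_le _ _).trans ((add_le_add h1 h2).trans (le_of_eq ?_))
      simp only [List.length_cons, List.map_cons, List.prod_cons, pow_succ]; ring
  intro U hU p
  refine (key U a g C D (ha.mono_order hU) (hg.mono_order hU) p).trans ?_
  have := mul_nonneg ha.nonneg hg.nonneg
  exact mul_le_mul_of_nonneg_right (mul_le_mul_of_nonneg_right
    (pow_le_pow_right₀ (by norm_num) hU) this) (prod_norm_nonneg _)

end DiffBound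

lemma hasFDerivAt_fdiffs {f : E → G} {f' : E → E →L[ℝ] G} (hf : ∀ p, HasFDerivAt f (f' p) p)
    (U : List E) (p : E) : HasFDerivAt (fdiffs U f) (fdiffs U f' p) p := by
  induction U generalizing p with
  | nil => exact hf p
  | cons u U ih => exact ((hasFDerivAt_comp_add_right u).2 (ih (p + u))).sub (ih p)

/-- A bounded function whose derivative is of class `B^r` is of class `B^{r+1}`. -/
lemma DiffBound.of_hasFDerivAt {r : ℕ} {C : ℝ} {f : E → G} {f' : E → E →L[ℝ] G}
    (hf : ∀ p, HasFDerivAt f (f' p) p) (hb : ∀ p, ‖f p‖ ≤ C) (h : DiffBound r C f') :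
    DiffBound (r + 1) C f := by
  intro U hU p
  cases U with
  | nil => simpa [fdiffs] using hb p
  | cons u U =>
    -- The mean value inequality trades the outermost difference along u for one derivative of the
    -- remaining differences.
    have := Convex.norm_image_sub_le_of_norm_hasFDerivWithin_le
      (s := Set.univ) (f := fdiffs U f) (f' := fun p => fdiffs U f' p)
      (fun q _ => (hasFDerivAt_fdiffs hf U q).hasFDerivWithinAt)
      (fun q _ => h U (by simpa using hU) q) convex_univ (Set.mem_univ p) (Set.mem_univ (p + u))
    simp only [fdiffs, List.map_cons, List.prod_cons]
    refine this.trans (le_of_eq ?_)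
    rw [add_sub_cancel_left]; ring

/-- A function with bounded differences of every order. -/
def BoundedDiffs (f : E → G) : Prop := ∀ r, ∃ C, DiffBound r C f

lemma BoundedDiffs.add {f g : E → G} (hf : BoundedDiffs f) (hg : BoundedDiffs g) :
    BoundedDiffs (fun p => f p + g p) := fun r => by
  obtain ⟨C, hC⟩ := hf r
  obtain ⟨D, hD⟩ := hg r
  exact ⟨_, hC.add hD⟩

lemma BoundedDiffs.clm {f : E → F} (hf : BoundedDiffs f) (L : F →L[ℝ] G) :
    BoundedDiffs (fun p => L (f p)) := fun r => by
  obtain ⟨C, hC⟩ := hf r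
  exact ⟨_, hC.clm L⟩

lemma BoundedDiffs.clm_comp {f : E → F →L[ℝ] G} (hf : BoundedDiffs f) (L : G →L[ℝ] H) :
    BoundedDiffs (fun p => L.comp (f p)) :=
  hf.clm (ContinuousLinearMap.compL ℝ F G H L)

lemma BoundedDiffs.comp_sub_right {f : E → G} (hf : BoundedDiffs f) (v : E) :
    BoundedDiffs (fun p => f (p - v)) := fun r => by
  obtain ⟨C, hC⟩ := hf r
  exact ⟨C, by simpa only [sub_eq_add_neg] using hC.comp_add_right (-v)⟩

/-- Induction on the order through `DiffBound.of_hasFDerivAt`: the derivative is again smooth with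
compact support. Its values lie in another space, hence the generalization over `G`. -/
lemma boundedDiffs_of_hasCompactSupport {f : E → G} (hf : ContDiff ℝ (⊤ : ℕ∞) f)
    (hs : HasCompactSupport f) : BoundedDiffs f := by
  intro r
  induction r generalizing G with
  | zero =>
    obtain ⟨C, hC⟩ := hf.continuous.bounded_above_of_compact_support hs
    exact ⟨C, DiffBound.of_norm_le hC⟩
  | succ r ih =>
    obtain ⟨C, hC⟩ := hf.continuous.bounded_above_of_compact_support hs
    obtain ⟨D, hD⟩ := ih (hf.fderiv_right (m := (⊤ : ℕ∞)) (by simp)) (hs.fderiv ℝ)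
    exact ⟨max C D, DiffBound.of_hasFDerivAt
      (fun p => (hf.differentiable (by simp) p).hasFDerivAt)
      (fun p => (hC p).trans (le_max_left _ _)) (hD.mono_const (le_max_right _ _))⟩

end Differences

/-! ### Chains as functionals on forms. -/

section Pairing

variable {E V W F : Type} [NormedAddCommGroup E] [NormedSpace ℝ E]
  [NormedAddCommGroup V] [NormedSpace ℝ V] [NormedAddCommGroup W] [NormedSpace ℝ W]
  [NormedAddCommGroup F] [NormedSpace ℝ F] {r : ℕ}

lemma evalForm_elt (ω : E → V →L[ℝ] F) (p : E) (α : V) : evalForm ω (elt p α) = ω p α := by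
  simp [evalForm]

/-- Differences of the chain are transposed to differences of the form; this translates the
estimates that define `Form` into `DiffBound`. -/
lemma evalForm_diffs (ω : E → V →L[ℝ] F) (U : List E) (p : E) (α : V) :
    evalForm ω (diffs U (elt p α)) = fdiffs U ω p α := by
  induction U generalizing p with
  | nil => exact evalForm_elt ω p α
  | cons u U ih =>
    simp only [diffs, LinearMap.comp_apply, fdiffs]
    rw [diff_diffs_comm, diff_elt, map_sub, map_sub, ih, ih]
    rfl

lemma DiffBound.norm_evalForm_le {C : ℝ} {ω : E → V →L[ℝ] F} (h : DiffBound r C ω)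
    (A : Pointed E V) : ‖evalForm ω A‖ ≤ C * rnorm r A := by
  refine le_mul_rnorm (fun A => ‖evalForm ω A‖) (by simp) (fun A B => ?_) h.nonneg
    (fun U hU p α => ?_) A
  · simpa using norm_add_le (evalForm ω A) (evalForm ω B)
  · rw [evalForm_diffs, size, ← mul_assoc]
    exact ContinuousLinearMap.le_of_opNorm_le _ (h U hU p) α

lemma Form.diffBound (ω : Form E V F r) : ∃ C, DiffBound r C ω.toFun := by
  obtain ⟨C, hC0, hC⟩ := ω.bounded
  refine ⟨C, fun U hU p => ContinuousLinearMap.opNorm_le_bound _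
    (mul_nonneg hC0 (prod_norm_nonneg U)) fun α => ?_⟩
  rw [← evalForm_diffs, mul_assoc]
  exact hC U hU p α

/-- The form of class `B^r` given by a field of functionals with bounded differences. -/
def DiffBound.toForm {C : ℝ} {ω : E → V →L[ℝ] F} (h : DiffBound r C ω) : Form E V F r where
  toFun := ω
  bounded' := ⟨C, fun _ hU p α =>
    (h.norm_evalForm_le _).trans (mul_le_mul_of_nonneg_left (rnorm_diffs_le hU p α) h.nonneg)⟩

variable [CompleteSpace F]

/-- The pairing of chains of order `r` with a form, which is meaningful for forms of class `B^r`. -/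
def pairing (r : ℕ) (ω : E → V →L[ℝ] F) : Chain E V r →L[ℝ] F :=
  (evalForm ω).extendOfNorm (ofPointed r)

lemma integral_eq_pairing (K : Chain E V r) (ω : Form E V F r) :
    integral K ω = pairing r ω.toFun K := rfl

lemma eq_of_eq_ofPointed {X : Type*} [TopologicalSpace X] [T2Space X] {f g : Chain E V r → X}
    (hf : Continuous f) (hg : Continuous g) (h : ∀ A, f (ofPointed r A) = g (ofPointed r A))
    (K : Chain E V r) : f K = g K :=
  (denseRange_ofPointed r).induction_on K (isClosed_eq hf hg) h

namespace DiffBound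

variable {C D : ℝ} {ω : E → V →L[ℝ] F}

lemma pairing_ofPointed (h : DiffBound r C ω) (A : Pointed E V) :
    pairing r ω (ofPointed r A) = evalForm ω A :=
  LinearMap.extendOfNorm_eq (denseRange_ofPointed r)
    ⟨C, by simpa only [norm_ofPointed] using h.norm_evalForm_le⟩ A

lemma norm_pairing_le (h : DiffBound r C ω) (K : Chain E V r) : ‖pairing r ω K‖ ≤ C * ‖K‖ :=
  LinearMap.norm_extendOfNorm_apply_le (denseRange_ofPointed r) C
    (by simpa only [norm_ofPointed] using h.norm_evalForm_le) K

end DiffBound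

lemma evalForm_add (ω η : E → V →L[ℝ] F) (A : Pointed E V) :
    evalForm (fun p => ω p + η p) A = evalForm ω A + evalForm η A := by
  induction A using Finsupp.induction_linear with
  | zero => simp
  | add f g hf hg => simp only [map_add, hf, hg]; abel
  | single p α => simp [evalForm]

lemma pairing_add {C D : ℝ} {ω η : E → V →L[ℝ] F} (hω : DiffBound r C ω) (hη : DiffBound r D η)
    (K : Chain E V r) :
    pairing r (fun p => ω p + η p) K = pairing r ω K + pairing r η K := by
  refine eq_of_eq_ofPointed (f := pairing r _) (g := fun K => pairing r ω K + pairing r η K)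
    (by fun_prop) (by fun_prop) (fun A => ?_) K
  rw [(hω.add hη).pairing_ofPointed, hω.pairing_ofPointed, hη.pairing_ofPointed, evalForm_add]

/-- If `evalForm` of `ω` factors over a linear map of pointed chains that extends to a continuous map
of chains, so does the pairing. -/
lemma pairing_comp {s : ℕ} {D : ℝ} {ω : E → W →L[ℝ] F} {η : E → V →L[ℝ] F}
    (hη : DiffBound r D η) (T : Chain E V r →L[ℝ] Chain E W s)
    (h : ∀ p α, pairing s ω (T (ofPointed r (elt p α))) = η p α) (K : Chain E V r) :
    pairing s ω (T K) = pairing r η K := by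
  refine eq_of_eq_ofPointed (f := fun K => pairing s ω (T K)) (g := pairing r η)
    (by fun_prop) (by fun_prop) (fun A => ?_) K
  rw [hη.pairing_ofPointed]
  induction A using Finsupp.induction_linear with
  | zero => simp
  | add f g hf hg => simp only [map_add, hf, hg]
  | single p α => rw [h, evalForm_elt]

lemma pairing_clm {G : Type} [NormedAddCommGroup G] [NormedSpace ℝ G] [CompleteSpace G]
    {C : ℝ} {ω : E → V →L[ℝ] F} (hω : DiffBound r C ω) (L : F →L[ℝ] G) (K : Chain E V r) :
    pairing r (fun p => L.comp (ω p)) K = L (pairing r ω K) := by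
  have h : DiffBound r _ (fun p => L.comp (ω p)) :=
    hω.clm ((ContinuousLinearMap.compL ℝ V F G) L)
  refine eq_of_eq_ofPointed (f := pairing r _) (g := fun K => L (pairing r ω K))
    (by fun_prop) (by fun_prop) (fun A => ?_) K
  rw [h.pairing_ofPointed, hω.pairing_ofPointed]
  induction A using Finsupp.induction_linear with
  | zero => simp
  | add f g hf hg => simp only [map_add, hf, hg]
  | single p α => simp [evalForm]

lemma pairing_sub {C D : ℝ} {ω η : E → V →L[ℝ] F} (hω : DiffBound r C ω) (hη : DiffBound r D η)
    (K : Chain E V r) :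
    pairing r (fun p => ω p - η p) K = pairing r ω K - pairing r η K := by
  have h := pairing_add (hω.sub hη) hη K
  simp only [sub_add_cancel] at h
  rw [h, add_sub_cancel_right]

lemma incl_ofPointed {s : ℕ} (h : r ≤ s) (A : Pointed E V) :
    incl h (ofPointed r A) = ofPointed s A :=
  extend_ofPointed _ _ A

lemma pairing_incl {s : ℕ} {C : ℝ} {ω : E → V →L[ℝ] F} (hω : DiffBound s C ω) (h : r ≤ s)
    (K : Chain E V r) : pairing s ω (incl h K) = pairing r ω K :=
  pairing_comp (hω.mono_order h) _ (fun p α => by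
    rw [incl_ofPointed, hω.pairing_ofPointed, evalForm_elt]) K

lemma pairing_mapCoeff {C : ℝ} {ω : E → W →L[ℝ] F} (hω : DiffBound r C ω) (T : V →L[ℝ] W)
    (K : Chain E V r) :
    pairing r ω (mapCoeff T r K) = pairing r (fun p => (ω p).comp T) K := by
  refine pairing_comp (hω.clm ((ContinuousLinearMap.compL ℝ V W F).flip T)) _ (fun p α => ?_) K
  rw [mapCoeff, extend_ofPointed, LinearMap.comp_apply, mapCoeffPointed_elt,
    hω.pairing_ofPointed, evalForm_elt]
  rfl

lemma Func.diffBound (f : Func E r) : ∃ C, DiffBound r C f.val := by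
  obtain ⟨C, hC⟩ := Form.diffBound f
  exact ⟨_, hC.clm (ContinuousLinearMap.apply ℝ ℝ (1 : ℝ))⟩

lemma pairing_mul {C : ℝ} {ω : E → V →L[ℝ] F} (hω : DiffBound r C ω) (f : Func E r)
    (K : Chain E V r) : pairing r ω (mul f K) = pairing r (fun p => f.val p • ω p) K := by
  obtain ⟨D, hD⟩ := f.diffBound
  refine pairing_comp (hD.smul hω) _ (fun p α => ?_) K
  rw [mul, extend_ofPointed, LinearMap.comp_apply, mulPointed_elt, hω.pairing_ofPointed,
    evalForm_elt]
  simp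

/-- The prederivative is dual to the directional derivative: on a simple element both sides are
limits of the same difference quotients, since the pairing is continuous. -/
lemma pairing_prederiv {C D : ℝ} {ω : E → V →L[ℝ] F} {ω' : E → E →L[ℝ] V →L[ℝ] F} (v : E)
    (hr : 1 ≤ r) (hω : DiffBound (r + 1) C ω) (hd : ∀ p, HasFDerivAt ω (ω' p) p)
    (hω' : DiffBound r D (fun p => ω' p v)) (K : Chain E V r) :
    pairing (r + 1) ω (prederiv v hr K) = pairing r (fun p => ω' p v) K := by
  refine pairing_comp hω' _ (fun p α => ?_) K
  rw [prederiv, extend_ofPointed]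
  have h1 := ((pairing (r + 1) ω).continuous.tendsto _).comp
    (tendsto_prederivPointedFun v hr (elt p α))
  refine tendsto_nhds_unique h1 ?_
  have h2 := ((hd p).hasLineDerivAt v).tendsto_slope_zero
  have h3 := ((ContinuousLinearMap.apply ℝ F α).continuous.tendsto _).comp h2
  refine h3.congr fun t => ?_
  simp only [Function.comp_apply, hω.pairing_ofPointed, diffQuot, map_smul, diff_elt, map_sub,
    evalForm_elt]
  simp

/-- Bounded pointwise convergence of forms implies convergence of the pairings. -/
lemma tendsto_pairing {ι : Type*} {l : Filter ι} {C D : ℝ} {ω : ι → E → V →L[ℝ] F}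
    {η : E → V →L[ℝ] F} (hω : ∀ᶠ i in l, DiffBound r C (ω i)) (hη : DiffBound r D η)
    (h : ∀ p α, Tendsto (fun i => ω i p α) l (𝓝 (η p α))) (K : Chain E V r) :
    Tendsto (fun i => pairing r (ω i) K) l (𝓝 (pairing r η K)) := by
  rcases l.eq_or_neBot with rfl | hl
  · exact tendsto_bot
  have hC : 0 ≤ C := let ⟨i, hi⟩ := hω.exists; hi.nonneg
  have hev : ∀ A : Pointed E V, Tendsto (fun i => evalForm (ω i) A) l (𝓝 (evalForm η A)) := by
    intro A
    induction A using Finsupp.induction_linear with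
    | zero => simp
    | add f g hf hg => simpa only [map_add] using hf.add hg
    | single p α => simpa only [evalForm_elt] using h p α
  rw [Metric.tendsto_nhds]
  intro ε hε
  -- Replacing K by a pointed chain within δ costs at most (C + D) δ ≤ ε / 2; the other half of ε is
  -- left for convergence on that pointed chain. The summand 1 keeps the denominator positive.
  set δ := ε / (2 * (C + D + 1)) with hδ
  have hD := hη.nonneg
  have hδ0 : 0 < δ := by positivity
  obtain ⟨A, hA⟩ : ∃ A, dist K (ofPointed r A) < δ :=
    (denseRange_ofPointed r).exists_dist_lt K hδ0
  filter_upwards [hω, Metric.tendsto_nhds.1 (hev A) (ε / 2) (by positivity)] with i hi hi2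
  have e : pairing r (ω i) K - pairing r η K = pairing r (ω i) (K - ofPointed r A)
      - pairing r η (K - ofPointed r A) + (evalForm (ω i) A - evalForm η A) := by
    rw [map_sub, map_sub, hi.pairing_ofPointed, hη.pairing_ofPointed]; abel
  rw [dist_eq_norm] at hA hi2
  rw [dist_eq_norm, e]
  have h1 := (hi.norm_pairing_le (K - ofPointed r A)).trans
    (mul_le_mul_of_nonneg_left hA.le hi.nonneg)
  have h2 := (hη.norm_pairing_le (K - ofPointed r A)).trans
    (mul_le_mul_of_nonneg_left hA.le hη.nonneg)
  have h3 := norm_add_le (pairing r (ω i) (K - ofPointed r A)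
      - pairing r η (K - ofPointed r A)) (evalForm (ω i) A - evalForm η A)
  have h4 := norm_sub_le (pairing r (ω i) (K - ofPointed r A))
    (pairing r η (K - ofPointed r A))
  have h5 : (C + D + 1) * δ = ε / 2 := by rw [hδ]; field_simp
  nlinarith

/-- A chain on which all forms of class `B^r` vanish is zero. -/
lemma eq_zero_of_pairing_eq_zero (K : Chain E V r)
    (h : ∀ (ω : E → V →L[ℝ] ℝ) (C : ℝ), DiffBound r C ω → pairing r ω K = 0) : K = 0 := by
  by_contra hK
  obtain ⟨g, -, hg⟩ := exists_dual_vector ℝ K (norm_ne_zero_iff.2 hK)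
  -- A norming functional g of K, restricted to simple elements, is itself a form of class B^r with
  -- bound ‖g‖, and pairing with it recovers g.
  let ω : E → V →L[ℝ] ℝ := fun p => LinearMap.mkContinuous
    ((g.toLinearMap.comp (ofPointed r)).comp (Finsupp.lsingle p)) ‖g‖ (fun α => by
      refine (g.le_opNorm _).trans (mul_le_mul_of_nonneg_left ?_ (norm_nonneg _))
      have := rnorm_diffs_le (r := r) (U := []) (Nat.zero_le _) p α
      simpa [norm_ofPointed, diffs, size] using this)
  have hev : ∀ A, evalForm ω A = g (ofPointed r A) := by
    intro A
    induction A using Finsupp.induction_linear with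
    | zero => simp
    | add f g hf hg => simp only [map_add, hf, hg]
    | single p α => rw [evalForm_elt]; rfl
  have hω : DiffBound r ‖g‖ ω := by
    intro U hU p
    refine ContinuousLinearMap.opNorm_le_bound _
      (mul_nonneg (norm_nonneg _) (prod_norm_nonneg U)) fun α => ?_
    rw [← evalForm_diffs, hev, mul_assoc]
    refine (g.le_opNorm _).trans (mul_le_mul_of_nonneg_left ?_ (norm_nonneg _))
    rw [norm_ofPointed]
    exact rnorm_diffs_le hU p α
  have h1 : pairing r ω K = g K := by
    refine eq_of_eq_ofPointed (f := pairing r ω) (g := g) (by fun_prop) (by fun_prop)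
      (fun A => ?_) K
    rw [hω.pairing_ofPointed, hev]
  rw [h ω _ hω, hg] at h1
  exact hK (norm_eq_zero.1 (by simpa using h1.symm))

end Pairing

/-! ### Localization and the support of a chain. -/

section Support

variable {V F : Type} [NormedAddCommGroup V] [NormedSpace ℝ V]
  [NormedAddCommGroup F] [NormedSpace ℝ F] {r : ℕ}

lemma boundedDiffs_contDiffBump {q : ℂ} (b : ContDiffBump q) : BoundedDiffs (b : ℂ → ℝ) :=
  boundedDiffs_of_hasCompactSupport b.contDiff b.hasCompactSupport

/-- These are dilations of one bump by factors at most 1, which do not increase the bounds on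
differences, so one constant serves all k. -/
lemma exists_cutoff : ∃ χ : ℕ → ℂ → ℝ, (∀ k, HasCompactSupport (χ k)) ∧
    (∀ r, ∃ C, ∀ k, DiffBound r C (χ k)) ∧ ∀ p, ∀ᶠ k in atTop, χ k p = 1 := by
  let b : ContDiffBump (0 : ℂ) := ⟨1, 2, one_pos, one_lt_two⟩
  have hpos : ∀ k : ℕ, (0 : ℝ) < (k : ℝ) + 1 := fun k => by positivity
  refine ⟨fun k p => b (((k : ℝ) + 1)⁻¹ • p), fun k => ?_, fun r => ?_, fun p => ?_⟩
  · exact b.hasCompactSupport.comp_smul (inv_ne_zero (hpos k).ne')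
  · obtain ⟨C, hC⟩ := boundedDiffs_contDiffBump b r
    refine ⟨C, fun k => hC.comp_smul ?_⟩
    rw [abs_of_pos (inv_pos.2 (hpos k))]
    exact inv_le_one_of_one_le₀ (by linarith [(Nat.cast_nonneg k : (0 : ℝ) ≤ k)])
  · obtain ⟨N, hN⟩ := exists_nat_gt ‖p‖
    filter_upwards [eventually_ge_atTop N] with k hk
    refine b.one_of_mem_closedBall ?_
    rw [mem_closedBall_zero_iff, norm_smul, norm_inv, Real.norm_of_nonneg (hpos k).le,
      inv_mul_le_iff₀ (hpos k)]
    have : (N : ℝ) ≤ k := by exact_mod_cast hk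
    change ‖p‖ ≤ _ * 1
    linarith

variable [CompleteSpace F]

/-- A form of class `B^r` pairs to zero with a chain if all its compactly supported cutoffs do. -/
lemma pairing_eq_zero_of_cutoff {C : ℝ} {ω : ℂ → V →L[ℝ] F} (hω : DiffBound r C ω)
    (K : Chain ℂ V r)
    (h : ∀ (a : ℂ → ℝ) (D : ℝ), HasCompactSupport a → DiffBound r D a →
      pairing r (fun p => a p • ω p) K = 0) : pairing r ω K = 0 := by
  obtain ⟨χ, h1, h2, h3⟩ := exists_cutoff
  obtain ⟨D, hD⟩ := h2 r
  have := tendsto_pairing (l := atTop) (Eventually.of_forall fun k => (hD k).smul hω) hω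
    (fun p α => (tendsto_const_nhds (x := ω p α)).congr' (by
      filter_upwards [h3 p] with k hk
      simp [hk])) K
  refine tendsto_nhds_unique this ?_
  simp only [h _ _ (h1 _) (hD _), tendsto_const_nhds]

lemma pairing_eq_zero_of_isSupportedBy {C : ℝ} {ω : ℂ → V →L[ℝ] F} (hω : DiffBound r C ω)
    {J : Chain ℂ V r} {X O : Set ℂ} (hX : IsSupportedBy J X) (hO : IsOpen O) (hne : O.Nonempty)
    (hXO : X ⊆ O) (h0 : ∀ w ∈ O, ω w = 0) : pairing r ω J = 0 := by
  obtain ⟨A, hA, hAJ⟩ := hX O hO hne hXO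
  refine tendsto_nhds_unique (((pairing r ω).continuous.tendsto J).comp hAJ) ?_
  refine tendsto_const_nhds.congr fun i => ?_
  rw [Function.comp_apply, hω.pairing_ofPointed, evalForm, Finsupp.lsum_apply, Finsupp.sum]
  refine (Finset.sum_eq_zero fun p hp => ?_).symm
  rw [h0 p (hA i hp)]
  simp

lemma isClosed_supp (J : Chain ℂ V r) : IsClosed (supp J) :=
  isClosed_sInter fun _ h => h.1

/-- Some closed supporting set X misses q. The chain is then a limit of pointed chains in the
complement of a small closed disc about q, where the bump vanishes. -/
lemma exists_contDiffBump_of_notMem_supp {J : Chain ℂ V r} {q : ℂ} (hq : q ∉ supp J) :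
    ∃ b : ContDiffBump q, ∀ (ω : ℂ → V →L[ℝ] F) (C : ℝ), DiffBound r C ω →
      pairing r (fun p => b p • ω p) J = 0 := by
  simp only [supp, Set.mem_sInter, not_forall] at hq
  obtain ⟨X, ⟨hXc, hX⟩, hqX⟩ := hq
  obtain ⟨δ, hδ, hball⟩ := Metric.isOpen_iff.1 hXc.isOpen_compl q hqX
  let b : ContDiffBump q := ⟨δ / 4, δ / 2, by positivity, by linarith⟩
  refine ⟨b, fun ω C hω => ?_⟩
  obtain ⟨D, hD⟩ := boundedDiffs_contDiffBump b r
  -- Nonemptiness of the open set has to be shown because X may be empty; q + δ lies outside the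
  -- disc of radius δ / 2.
  refine pairing_eq_zero_of_isSupportedBy (hD.smul hω) hX
    (O := (Metric.closedBall q (δ / 2))ᶜ) Metric.isClosed_closedBall.isOpen_compl
    ⟨q + δ, ?_⟩ ?_ ?_
  · simp only [Set.mem_compl_iff, Metric.mem_closedBall, dist_self_add_left, Complex.norm_real,
      Real.norm_of_nonneg hδ.le]
    linarith
  · rw [Set.subset_compl_comm]
    exact (Metric.closedBall_subset_ball (by linarith)).trans hball
  · intro w hw
    have : b w = 0 := by
      refine b.zero_of_le_dist ?_
      simp only [Set.mem_compl_iff, Metric.mem_closedBall, not_le] at hw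
      exact hw.le
    simp [this]

lemma pairing_zero_form (K : Chain ℂ V r) : pairing r (fun _ => (0 : V →L[ℝ] F)) K = 0 := by
  have h : DiffBound r 0 (fun _ : ℂ => (0 : V →L[ℝ] F)) := by
    intro U _ p
    have := fdiffs_clm (0 : (V →L[ℝ] F) →L[ℝ] (V →L[ℝ] F)) U (fun _ => 0) p
    simp only [zero_apply] at this
    simp [this]
  simpa using h.norm_pairing_le K

/-- A form of class `B^r` that vanishes in a neighbourhood of the support of a chain of order `r`
pairs to zero with it. -/
lemma pairing_eq_zero_of_supp {C : ℝ} {ω : ℂ → V →L[ℝ] F} (hω : DiffBound r C ω)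
    {J : Chain ℂ V r} {O : Set ℂ} (hO : IsOpen O) (hJ : supp J ⊆ O) (h0 : ∀ w ∈ O, ω w = 0) :
    pairing r ω J = 0 := by
  refine pairing_eq_zero_of_cutoff hω J fun a D ha hD => ?_
  have hb := fun q : ((supp J)ᶜ : Set ℂ) => exists_contDiffBump_of_notMem_supp (F := F) q.2
  choose b hb using hb
  have hK : IsCompact (tsupport a \ O) := ha.isCompact.diff hO
  obtain ⟨t, ht⟩ := hK.elim_nhds_subcover' (fun q hq => {w | b ⟨q, fun h => hq.2 (hJ h)⟩ w = 1})
    (fun q hq => (b ⟨q, fun h => hq.2 (hJ h)⟩).eventuallyEq_one)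
  -- The support is only the intersection of the supporting sets, so the local vanishing must be
  -- patched together. Replacing η by η - b_q η leaves the pairing unchanged and removes the points
  -- where b_q = 1; after finitely many steps the form is zero.
  have key : ∀ (t : Finset (tsupport a \ O : Set ℂ)) (η : ℂ → V →L[ℝ] F) (C : ℝ),
      DiffBound r C η →
      (∀ w, η w ≠ 0 → ∃ q ∈ t, b ⟨q, fun h => q.2.2 (hJ h)⟩ w = 1) → pairing r η J = 0 := by
    classical
    intro t
    induction t using Finset.induction_on with
    | empty =>
      intro η C _ h
      have : η = fun _ => 0 := funext fun w => by
        by_contra hw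
        simpa using h w hw
      rw [this, pairing_zero_form]
    | insert q t _ ih =>
      intro η C hη h
      obtain ⟨B, hB⟩ := boundedDiffs_contDiffBump (b ⟨q, fun h => q.2.2 (hJ h)⟩) r
      have h1 := ih _ _ (hη.sub (hB.smul hη)) (fun w hw => by
        have hw0 : η w ≠ 0 := by rintro h; simp [h] at hw
        obtain ⟨q', hq', h1⟩ := h w hw0
        rcases Finset.mem_insert.1 hq' with rfl | hq'
        · simp [h1] at hw
        · exact ⟨q', hq', h1⟩)
      rw [pairing_sub hη (hB.smul hη), hb _ _ _ hη, sub_zero] at h1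
      exact h1
  refine key t _ _ (hD.smul hω) fun w hw => ?_
  have hw1 : w ∈ tsupport a \ O := by
    refine ⟨subset_tsupport _ fun h => hw (by simp [h]), fun h => hw (by simp [h0 w h])⟩
  simpa using ht hw1

end Support

/-! ### Stokes' formula. -/

section Boundary

variable {F : Type} [NormedAddCommGroup F] [NormedSpace ℝ F] [CompleteSpace F]

/-- The exterior derivative of a `1`-form with derivative `ω'`. -/
def extDeriv (ω' : ℂ → ℂ →L[ℝ] ℂ →L[ℝ] F) (p : ℂ) : ℝ →L[ℝ] F :=
  (ω' p 1).comp (retract2 1) + (ω' p Complex.I).comp (retract2 Complex.I)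

lemma extDeriv_one (ω' : ℂ → ℂ →L[ℝ] ℂ →L[ℝ] F) (p : ℂ) :
    extDeriv ω' p 1 = ω' p 1 Complex.I - ω' p Complex.I 1 := by
  simp [extDeriv, retract2, sub_eq_add_neg]

lemma diffBound_extDeriv {n : ℕ} {D : ℝ} {ω' : ℂ → ℂ →L[ℝ] ℂ →L[ℝ] F} (h : DiffBound n D ω') :
    ∃ C, DiffBound n C (extDeriv ω') := by
  have h1 : ∀ v : ℂ, DiffBound n _ (fun p => ω' p v) := fun v =>
    h.clm (ContinuousLinearMap.apply ℝ _ v)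
  have h2 : ∀ v : ℂ, DiffBound n _ (fun p => (ω' p v).comp (retract2 v)) := fun v =>
    (h1 v).clm ((ContinuousLinearMap.compL ℝ ℝ ℂ F).flip (retract2 v))
  exact ⟨_, (h2 1).add (h2 Complex.I)⟩

/-- Stokes' theorem for `2`-chains. -/
lemma pairing_boundary2 {n : ℕ} (hn : 1 ≤ n) {C D : ℝ} {ω : ℂ → ℂ →L[ℝ] F}
    {ω' : ℂ → ℂ →L[ℝ] ℂ →L[ℝ] F} (hω : DiffBound (n + 1) C ω)
    (hd : ∀ p, HasFDerivAt ω (ω' p) p) (hω' : DiffBound n D ω') (K : Chain2 n) :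
    pairing (n + 1) ω (boundary2 hn K) = pairing n (extDeriv ω') K := by
  have h : ∀ v : ℂ, DiffBound n _ (fun p => ω' p v) := fun v =>
    hω'.clm (ContinuousLinearMap.apply ℝ _ v)
  have h2 : ∀ v : ℂ, DiffBound n _ (fun p => (ω' p v).comp (retract2 v)) := fun v =>
    (h v).clm ((ContinuousLinearMap.compL ℝ ℝ ℂ F).flip (retract2 v))
  simp only [boundary2, add_apply, ContinuousLinearMap.comp_apply, map_add]
  rw [pairing_prederiv _ hn hω hd (h _), pairing_prederiv _ hn hω hd (h _),
    pairing_mapCoeff (h _), pairing_mapCoeff (h _), ← pairing_add (h2 _) (h2 _)]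
  rfl

/-- The identity ∂K = J holds only in some common order n. As the forms have bounds of every order
and pairings are unaffected by `incl`, the result descends to the orders of J and K. -/
lemma IsBoundary.pairing_eq {r s : ℕ} {K : Chain2 s} {J : Chain1 r} (h : IsBoundary K J)
    {ω : ℂ → ℂ →L[ℝ] F} {ω' : ℂ → ℂ →L[ℝ] ℂ →L[ℝ] F} (hω : BoundedDiffs ω)
    (hd : ∀ p, HasFDerivAt ω (ω' p) p) (hω' : BoundedDiffs ω') :
    pairing r ω J = pairing s (extDeriv ω') K := by
  obtain ⟨n, hn, hs, hr, h⟩ := h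
  obtain ⟨C, hC⟩ := hω (n + 1)
  obtain ⟨D, hD⟩ := hω' n
  obtain ⟨B, hB⟩ := diffBound_extDeriv hD
  rw [← pairing_incl hC hr, ← h, pairing_boundary2 hn hC hd hD, pairing_incl hB hs]

end Boundary

/-! ### Functions as forms with scalar coefficients. -/

section ScalarForms

variable {E F : Type} [NormedAddCommGroup E] [NormedSpace ℝ E]
  [NormedAddCommGroup F] [NormedSpace ℝ F] {r : ℕ} {C : ℝ}

/-- The form `a ↦ a • f p` with one-dimensional coefficients. -/
def scalarForm (f : E → F) (p : E) : ℝ →L[ℝ] F := ContinuousLinearMap.toSpanSingleton ℝ (f p)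

@[simp] lemma scalarForm_apply (f : E → F) (p : E) (a : ℝ) : scalarForm f p a = a • f p := rfl

lemma scalarForm_eval_one (ω : E → ℝ →L[ℝ] F) : scalarForm (fun p => ω p 1) = ω := by
  funext p; ext; simp

lemma fdiffs_scalarForm (f : E → F) (U : List E) (p : E) :
    fdiffs U (scalarForm f) p = scalarForm (fdiffs U f) p := by
  induction U generalizing p with
  | nil => rfl
  | cons u U ih => ext; simp [fdiffs, ih]

lemma DiffBound.scalarForm {f : E → F} (h : DiffBound r C f) :
    DiffBound r C (DiffChain.scalarForm f) := by
  intro U hU p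
  rw [fdiffs_scalarForm, DiffChain.scalarForm, ContinuousLinearMap.norm_toSpanSingleton]
  exact h U hU p

lemma DiffBound.eval_one {ω : E → ℝ →L[ℝ] F} (h : DiffBound r C ω) :
    ∃ D, DiffBound r D (fun p => ω p 1) :=
  ⟨_, h.clm (ContinuousLinearMap.apply ℝ F (1 : ℝ))⟩

lemma DiffBound.lipschitz {f : E → F} (h : DiffBound (r + 1) C f) (p q : E) :
    ‖f p - f q‖ ≤ C * ‖p - q‖ := by
  simpa using (h.diff (p - q)).norm_le q

lemma continuous_of_norm_sub_le {f : E → F} (h : ∀ p q, ‖f p - f q‖ ≤ C * ‖p - q‖) :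
    Continuous f := by
  refine (LipschitzWith.of_dist_le_mul (K := C.toNNReal) fun p q => ?_).continuous
  rw [dist_eq_norm, dist_eq_norm]
  exact (h p q).trans (mul_le_mul_of_nonneg_right (Real.le_coe_toNNReal C) (norm_nonneg _))

/-- A bound on first differences is a Lipschitz bound. In order 0 there is none, which is why that
order needs separate treatment below. -/
lemma DiffBound.continuous {f : E → F} (h : DiffBound r C f) (hr : 1 ≤ r) : Continuous f :=
  continuous_of_norm_sub_le (h.mono_order (r := 0 + 1) hr).lipschitz

lemma DiffBound.comp_sub_right {f : E → F} (hf : DiffBound r C f) (v : E) :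
    DiffBound r C (fun p => f (p - v)) := by
  simpa only [sub_eq_add_neg] using hf.comp_add_right (-v)

lemma continuous_fdiffs {f : E → F} (hf : Continuous f) (U : List E) :
    Continuous (fdiffs U f) := by
  induction U with
  | nil => exact hf
  | cons u U ih => exact (ih.comp (continuous_id.add continuous_const)).sub ih

end ScalarForms

/-! ### Translation invariance where the boundary vanishes. -/

section Translation

/-- The boundary of `K` vanishes on `Q`: derivatives of test functions in `Q` pair to zero
with `K`. -/
def IsCycleOn {s : ℕ} (K : Chain2 s) (Q : Set ℂ) : Prop :=
  ∀ g : ℂ → ℝ, ContDiff ℝ (⊤ : ℕ∞) g → HasCompactSupport g → tsupport g ⊆ Q → ∀ v,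
    pairing s (scalarForm fun p => fderiv ℝ g p v) K = 0

lemma IsCycleOn.mono {s : ℕ} {K : Chain2 s} {Q R : Set ℂ} (h : IsCycleOn K R) (hQ : Q ⊆ R) :
    IsCycleOn K Q := fun g h1 h2 h3 => h g h1 h2 (h3.trans hQ)

lemma boundedDiffs_fderiv {g : ℂ → ℝ} (hg : ContDiff ℝ (⊤ : ℕ∞) g) (hs : HasCompactSupport g) :
    BoundedDiffs (fderiv ℝ g) :=
  boundedDiffs_of_hasCompactSupport (hg.fderiv_right (m := (⊤ : ℕ∞)) (by simp)) (hs.fderiv ℝ)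

/-- The 1-form g (v₁ dy - v₂ dx) has exterior derivative (∂_v g) dx ∧ dy. -/
lemma IsBoundary.pairing_fderiv {r s : ℕ} {K : Chain2 s} {J : Chain1 r} (h : IsBoundary K J)
    {g : ℂ → ℝ} (hg : ContDiff ℝ (⊤ : ℕ∞) g) (hs : HasCompactSupport g) (v : ℂ) :
    pairing s (scalarForm fun p => fderiv ℝ g p v) K
      = pairing r (fun p => g p • (v.re • Complex.imCLM - v.im • Complex.reCLM)) J := by
  let L : ℝ →L[ℝ] ℂ →L[ℝ] ℝ := (ContinuousLinearMap.id ℝ ℝ).smulRight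
    (v.re • Complex.imCLM - v.im • Complex.reCLM)
  have h1 := h.pairing_eq (ω := fun p => L (g p)) (ω' := fun p => L.comp (fderiv ℝ g p))
    ((boundedDiffs_of_hasCompactSupport hg hs).clm L)
    (fun p => L.hasFDerivAt.comp p (hg.differentiable (by simp) p).hasFDerivAt)
    ((boundedDiffs_fderiv hg hs).clm_comp L)
  have e : scalarForm (fun p => fderiv ℝ g p v)
      = extDeriv fun p => L.comp (fderiv ℝ g p) := by
    rw [← scalarForm_eval_one (extDeriv _)]
    congr 1
    funext p
    rw [extDeriv_one]
    have hv : v = v.re • (1 : ℂ) + v.im • Complex.I := by simp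
    conv_lhs => rw [hv, map_add, map_smul, map_smul]
    simp [L]
    ring
  rw [e, ← h1]
  rfl

/-- The primitive g (v₁ dy - v₂ dx) vanishes near supp J when the support of g misses it. -/
lemma IsBoundary.isCycleOn {r s : ℕ} {K : Chain2 s} {J : Chain1 r} (h : IsBoundary K J) :
    IsCycleOn K (supp J)ᶜ := by
  intro g hg hs hsupp v
  rw [h.pairing_fderiv hg hs]
  obtain ⟨C, hC⟩ := boundedDiffs_of_hasCompactSupport hg hs r
  refine pairing_eq_zero_of_supp
    (hC.clm ((ContinuousLinearMap.id ℝ ℝ).smulRight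
      (v.re • Complex.imCLM - v.im • Complex.reCLM)))
    (isClosed_tsupport g).isOpen_compl (Set.subset_compl_comm.1 hsupp) (fun w hw => ?_)
  simp [image_eq_zero_of_notMem_tsupport hw]

lemma tsupport_comp_sub_subset (φ : ℂ → ℝ) (v : ℂ) {p : ℂ}
    (hp : p ∈ tsupport fun q => φ (q - v)) : p - v ∈ tsupport φ := by
  have hc : IsClosed ((fun q : ℂ => q - v) ⁻¹' tsupport φ) :=
    (isClosed_tsupport φ).preimage (by fun_prop)
  refine closure_minimal (fun q hq => ?_) hc hp
  exact subset_tsupport φ hq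

lemma hasCompactSupport_comp_sub {φ : ℂ → ℝ} (h : HasCompactSupport φ) (v : ℂ) :
    HasCompactSupport fun q => φ (q - v) :=
  h.comp_homeomorph (Homeomorph.subRight v)

/-- A `2`-chain without boundary in `Q` is invariant under translations in `Q`. -/
lemma IsCycleOn.pairing_translate {s : ℕ} {K : Chain2 s} {Q : Set ℂ} (hK : IsCycleOn K Q)
    {φ : ℂ → ℝ} (hφ : ContDiff ℝ (⊤ : ℕ∞) φ) (hs : HasCompactSupport φ) {y : ℂ}
    (hy : ∀ t ∈ Set.Icc (0 : ℝ) 1, ∀ p ∈ tsupport φ, p + t • y ∈ Q) :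
    pairing s (scalarForm fun p => φ (p - y)) K = pairing s (scalarForm φ) K := by
  obtain ⟨C, hC⟩ := boundedDiffs_of_hasCompactSupport hφ hs (s + 1)
  set G : ℝ → ℝ := fun t => pairing s (scalarForm fun p => φ (p - t • y)) K with hG
  have hder : ∀ t ∈ Set.Icc (0 : ℝ) 1, HasDerivAt G 0 t := by
    intro t ht
    set ψ : ℂ → ℝ := fun p => φ (p - t • y) with hψ
    have hψd : ContDiff ℝ (⊤ : ℕ∞) ψ := hφ.comp (contDiff_id.sub contDiff_const)
    have hψs : HasCompactSupport ψ := hasCompactSupport_comp_sub hs _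
    have h0 : pairing s (scalarForm fun p => fderiv ℝ ψ p (-y)) K = 0 := by
      refine hK ψ hψd hψs (fun p hp => ?_) _
      simpa using hy t ht _ (tsupport_comp_sub_subset φ _ hp)
    have hψC : DiffBound (s + 1) C ψ := hC.comp_sub_right _
    obtain ⟨D, hD⟩ := boundedDiffs_fderiv hψd hψs s
    -- The difference quotients in t converge boundedly to the derivative of ψ along -y, on which K
    -- vanishes; hence G has derivative 0.
    have hlim := tendsto_pairing (l := 𝓝[≠] (0 : ℝ))
      (ω := fun τ => scalarForm fun p => τ⁻¹ • (ψ (p + τ • (-y)) - ψ p))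
      (η := scalarForm fun p => fderiv ℝ ψ p (-y))
      (by filter_upwards [self_mem_nhdsWithin] with τ hτ using (hψC.diffQuot (-y) hτ).scalarForm)
      (hD.clm (ContinuousLinearMap.apply ℝ ℝ (-y))).scalarForm
      (fun p a => ((((hψd.differentiable (by simp) p).hasFDerivAt.hasLineDerivAt
        (-y)).tendsto_slope_zero).const_smul a)) K
    rw [h0] at hlim
    rw [hasDerivAt_iff_tendsto_slope_zero]
    refine hlim.congr' ?_
    filter_upwards [self_mem_nhdsWithin] with τ hτ
    have e : (fun p => scalarForm (fun p => τ⁻¹ • (ψ (p + τ • (-y)) - ψ p)) p)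
        = fun p => (τ⁻¹ • ContinuousLinearMap.id ℝ ℝ).comp
          (scalarForm (fun p => φ (p - (t + τ) • y)) p - scalarForm ψ p) := by
      funext p
      ext
      simp only [hψ, scalarForm_apply, ContinuousLinearMap.comp_apply, sub_apply, smul_apply,
        ContinuousLinearMap.id_apply, add_smul, smul_neg]
      rw [show p + -(τ • y) - t • y = p - (t • y + τ • y) by abel]
      simp
    have hb := (hC.mono_order (Nat.le_succ s))
    change pairing s (fun p => scalarForm _ p) K = _
    rw [e, pairing_clm ((hb.comp_sub_right _).scalarForm.sub (hb.comp_sub_right _).scalarForm),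
      pairing_sub (hb.comp_sub_right _).scalarForm (hb.comp_sub_right _).scalarForm]
    rfl
  have := constant_of_has_deriv_right_zero (f := G) (a := 0) (b := 1)
    (fun t ht => (hder t ht).continuousAt.continuousWithinAt)
    (fun t ht => (hder t (Set.Ico_subset_Icc_self ht)).hasDerivWithinAt) 1
    (Set.right_mem_Icc.2 zero_le_one)
  simpa [hG] using this

end Translation

/-! ### Convolution under the pairing. -/

section Mollification

lemma integrable_mul_comp_sub {ρ h : ℂ → ℝ} (hρ : Continuous ρ) (hs : HasCompactSupport ρ)
    (hh : Continuous h) (p : ℂ) : Integrable fun y => ρ y * h (p - y) :=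
  (hρ.mul (hh.comp (continuous_const.sub continuous_id))).integrable_of_hasCompactSupport
    hs.mul_right

/-- All differences fall on h, so only the L¹ norm of ρ enters. -/
lemma DiffBound.conv {r : ℕ} {C : ℝ} {ρ h : ℂ → ℝ} (hC : DiffBound r C h) (hρ : Continuous ρ)
    (hs : HasCompactSupport ρ) (hh : Continuous h) :
    DiffBound r (C * ∫ y, |ρ y|) (fun x => ∫ y, ρ y * h (x - y)) := by
  have key : ∀ (U : List ℂ) p, fdiffs U (fun x => ∫ y, ρ y * h (x - y)) p
      = ∫ y, ρ y * fdiffs U h (p - y) := by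
    intro U
    induction U with
    | nil => intro p; rfl
    | cons u U ih =>
      intro p
      simp only [fdiffs, ih]
      rw [← integral_sub (integrable_mul_comp_sub hρ hs (continuous_fdiffs hh U) _)
        (integrable_mul_comp_sub hρ hs (continuous_fdiffs hh U) _)]
      simp only [mul_sub, sub_add_eq_add_sub]
  intro U hU p
  rw [key]
  have hi : Integrable fun y => |ρ y| :=
    (hρ.integrable_of_hasCompactSupport hs).abs
  refine (norm_integral_le_of_norm_le (hi.mul_const (C * (U.map fun u => ‖u‖).prod))
    (Eventually.of_forall fun y => ?_)).trans (le_of_eq ?_)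
  · rw [norm_mul, Real.norm_eq_abs]
    exact mul_le_mul_of_nonneg_left (hC U hU _) (abs_nonneg _)
  · rw [integral_mul_const]; ring

/-- The order r + 1 of φ makes the translates of φ depend Lipschitz continuously on y as functionals
on chains. The integral then exists in the dual space, and equality is checked on pointed chains. -/
lemma pairing_conv {r : ℕ} {C : ℝ} {h φ : ℂ → ℝ} (hφ : DiffBound (r + 1) C φ)
    (hh : Continuous h) (hs : HasCompactSupport h) (K : Chain2 r) :
    pairing r (scalarForm fun x => ∫ y, h y * φ (x - y)) K
      = ∫ y, h y * pairing r (scalarForm fun x => φ (x - y)) K := by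
  have hφc := hφ.continuous (Nat.le_add_left _ _)
  have hφr := hφ.mono_order (Nat.le_succ r)
  set Φ : ℂ → Chain2 r →L[ℝ] ℝ := fun y => pairing r (scalarForm fun x => φ (x - y)) with hΦ
  have hΦc : Continuous Φ := by
    refine continuous_of_norm_sub_le (C := C) fun y z => ?_
    rw [norm_sub_rev]
    refine ContinuousLinearMap.opNorm_le_bound _
      (mul_nonneg hφ.nonneg (norm_nonneg _)) fun A => ?_
    have h1 := pairing_sub (hφr.comp_sub_right z).scalarForm (hφr.comp_sub_right y).scalarForm A
    rw [sub_apply, hΦ, ← h1]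
    have h2 := (((hφ.diff (y - z)).comp_sub_right y).scalarForm).norm_pairing_le A
    have e : (fun p => scalarForm (fun p => φ (p - z)) p - scalarForm (fun p => φ (p - y)) p)
        = scalarForm (fun p => φ (p - y + (y - z)) - φ (p - y)) := by
      funext p
      ext
      simp
    rw [e]
    exact h2
  have hint : Integrable fun y => h y • Φ y :=
    (hh.smul hΦc).integrable_of_hasCompactSupport hs.smul_right
  have hb := (hφr.conv hh hs hφc).scalarForm
  have key := eq_of_eq_ofPointed (f := pairing r (scalarForm fun x => ∫ y, h y * φ (x - y)))
    (g := ⇑(∫ y, h y • Φ y : Chain2 r →L[ℝ] ℝ)) (by fun_prop) (by fun_prop) (fun A => ?_) K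
  · rw [key, ContinuousLinearMap.integral_apply hint]
    rfl
  · rw [hb.pairing_ofPointed]
    induction A using Finsupp.induction_linear with
    | zero => simp
    | add f g hf hg => simp only [map_add, hf, hg]
    | single p a =>
      rw [ContinuousLinearMap.integral_apply hint, evalForm_elt, scalarForm_apply, smul_eq_mul,
        ← integral_const_mul]
      congr 1
      funext y
      rw [smul_apply, hΦ, (hφr.comp_sub_right y).scalarForm.pairing_ofPointed, evalForm_elt]
      simp only [scalarForm_apply, smul_eq_mul]
      ring

/-- Bump functions about `p` with shrinking supports. -/
def shrinkingBump (p : ℂ) (i : ℕ) : ContDiffBump p :=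
  ⟨1 / ((i : ℝ) + 1) / 2, 1 / ((i : ℝ) + 1), by positivity, half_lt_self (by positivity)⟩

lemma tendsto_shrinkingBump_rOut (p : ℂ) :
    Tendsto (fun i => (shrinkingBump p i).rOut) atTop (𝓝 0) :=
  tendsto_one_div_add_atTop_nhds_zero_nat

/-- The convolutions ρᵢ * h tend to h boundedly. Read as h * ρᵢ, they average the translates ρᵢ(· -
y) over the support of h, where K takes the constant value cᵢ. -/
lemma tendsto_pairing_mollify {s : ℕ} (K : Chain2 s) {h : ℂ → ℝ} {C : ℝ} (hC : DiffBound s C h)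
    (hh : Continuous h) (hs : HasCompactSupport h) (c : ℕ → ℝ)
    (hc : ∀ᶠ i in atTop, ∀ y, h y ≠ 0 →
      pairing s (scalarForm fun p => (shrinkingBump 0 i).normed volume (p - y)) K = c i) :
    Tendsto (fun i => c i * ∫ y, h y) atTop (𝓝 (pairing s (scalarForm h) K)) := by
  set ρ : ℕ → ℂ → ℝ := fun i => (shrinkingBump 0 i).normed volume with hρ
  have h1 : ∀ i, ∫ y, |ρ i y| = 1 := by
    intro i
    rw [← (shrinkingBump (0 : ℂ) i).integral_normed (μ := volume)]
    congr 1
    funext y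
    exact abs_of_nonneg ((shrinkingBump (0 : ℂ) i).nonneg_normed y)
  have hb : ∀ i, DiffBound s C (fun x => ∫ y, ρ i y * h (x - y)) := by
    intro i
    have := hC.conv ((shrinkingBump (0 : ℂ) i).continuous_normed (μ := volume))
      (shrinkingBump (0 : ℂ) i).hasCompactSupport_normed hh
    change DiffBound s (C * ∫ y, |ρ i y|) _ at this
    rwa [h1, mul_one] at this
  have hpt : ∀ x, Tendsto (fun i => ∫ y, ρ i y * h (x - y)) atTop (𝓝 (h x)) := fun x =>
    ContDiffBump.convolution_tendsto_right_of_continuous (tendsto_shrinkingBump_rOut 0) hh x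
  have hlim := tendsto_pairing (l := atTop) (Eventually.of_forall fun i => (hb i).scalarForm)
    hC.scalarForm (fun p a => (hpt p).const_smul a) K
  refine hlim.congr' ?_
  filter_upwards [hc] with i hi
  obtain ⟨D, hD⟩ := boundedDiffs_of_hasCompactSupport
    ((shrinkingBump (0 : ℂ) i).contDiff_normed (μ := volume))
    (shrinkingBump (0 : ℂ) i).hasCompactSupport_normed (s + 1)
  have e : (fun x => ∫ y, ρ i y * h (x - y)) = fun x => ∫ y, h y * ρ i (x - y) := by
    funext x
    rw [← integral_sub_left_eq_self _ volume x]
    simp only [sub_sub_cancel, mul_comm]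
  rw [e, pairing_conv hD hh hs, ← integral_const_mul]
  congr 1
  funext y
  by_cases hy : h y = 0
  · simp [hy]
  · rw [hi y hy, mul_comm]

end Mollification

/-! ### The constancy theorem and uniqueness. -/

section Constancy

lemma hasCompactSupport_of_ne_zero {h : ℂ → ℝ} {z : ℂ} {R : ℝ}
    (hs : ∀ p, h p ≠ 0 → p ∈ Metric.closedBall z R) : HasCompactSupport h :=
  HasCompactSupport.of_support_subset_isCompact (isCompact_closedBall z R) hs

lemma exists_normalized_bump (z : ℂ) {R : ℝ} (hR : 0 < R) :
    ∃ h : ℂ → ℝ, ContDiff ℝ (⊤ : ℕ∞) h ∧ BoundedDiffs h ∧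
      (∀ p, h p ≠ 0 → p ∈ Metric.closedBall z R) ∧ ∫ p, h p = 1 := by
  let b : ContDiffBump z := ⟨R / 2, R, by positivity, by linarith⟩
  refine ⟨b.normed volume, b.contDiff_normed, boundedDiffs_of_hasCompactSupport b.contDiff_normed
    b.hasCompactSupport_normed, fun p hp => ?_, b.integral_normed⟩
  have : p ∈ Function.support (b.normed volume) := hp
  rw [b.support_normed_eq] at this
  exact Metric.ball_subset_closedBall this

/-- A `2`-chain of order at least `1` is a multiple of Lebesgue measure where it has no boundary. -/
lemma IsCycleOn.exists_const_of_one_le {s : ℕ} (hs : 1 ≤ s) {K : Chain2 s} {z : ℂ} {R R' : ℝ}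
    (hR : 0 < R) (hRR : R < R') (hK : IsCycleOn K (Metric.ball z R')) :
    ∃ d : ℝ, ∀ (h : ℂ → ℝ) (C : ℝ), DiffBound s C h →
      (∀ p, h p ≠ 0 → p ∈ Metric.closedBall z R) →
      pairing s (scalarForm h) K = d * ∫ p, h p := by
  set c : ℕ → ℝ := fun i =>
    pairing s (scalarForm fun p => (shrinkingBump 0 i).normed volume (p - z)) K with hc
  have key : ∀ (h : ℂ → ℝ) (C : ℝ), DiffBound s C h →
      (∀ p, h p ≠ 0 → p ∈ Metric.closedBall z R) →
      Tendsto (fun i => c i * ∫ p, h p) atTop (𝓝 (pairing s (scalarForm h) K)) := by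
    intro h C hC hh
    refine tendsto_pairing_mollify K hC (hC.continuous hs) (hasCompactSupport_of_ne_zero hh) c ?_
    -- A bump of radius below R' - R stays in the large disc while its centre moves along the
    -- segment from z to y.
    filter_upwards [(tendsto_shrinkingBump_rOut 0).eventually_lt_const (sub_pos.2 hRR)] with i hi
    intro y hy
    have hb := (shrinkingBump (0 : ℂ) i).contDiff_normed (μ := volume) (n := ⊤)
    have hbs := (shrinkingBump (0 : ℂ) i).hasCompactSupport_normed (μ := volume)
    have := hK.pairing_translate (y := y - z)
      (φ := fun p => (shrinkingBump 0 i).normed volume (p - z))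
      (hb.comp (contDiff_id.sub contDiff_const)) (hasCompactSupport_comp_sub hbs z)
      (fun t ht p hp => by
        have h1 := tsupport_comp_sub_subset _ _ hp
        rw [(shrinkingBump (0 : ℂ) i).tsupport_normed_eq, mem_closedBall_zero_iff] at h1
        have h2 := hh y hy
        rw [mem_closedBall_iff_norm] at h2
        rw [mem_ball_iff_norm, add_sub_right_comm]
        refine (norm_add_le _ _).trans_lt ?_
        rw [norm_smul, Real.norm_of_nonneg ht.1]
        have := mul_le_of_le_one_left (norm_nonneg (y - z)) ht.2
        linarith)
    simpa only [sub_sub, sub_add_cancel] using this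
  -- Convergence of cᵢ is not known beforehand; testing with one h₀ of integral 1 gives it, with
  -- limit the pairing of K and h₀.
  obtain ⟨h₀, -, hb, hsupp, hint⟩ := exists_normalized_bump z hR
  obtain ⟨C₀, hC₀⟩ := hb s
  have h0 := key h₀ C₀ hC₀ hsupp
  simp only [hint, mul_one] at h0
  exact ⟨_, fun h C hC hh => tendsto_nhds_unique (key h C hC hh) (h0.mul_const _)⟩

lemma IsCycleOn.incl {s t : ℕ} (hst : s ≤ t) {K : Chain2 s} {Q : Set ℂ} (hK : IsCycleOn K Q) :
    IsCycleOn (DiffChain.incl hst K) Q := by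
  intro g hg hs hQ v
  obtain ⟨C, hC⟩ := boundedDiffs_fderiv hg hs t
  have hb : DiffBound t _ (scalarForm fun p => fderiv ℝ g p v) :=
    (hC.clm (ContinuousLinearMap.apply ℝ ℝ v)).scalarForm
  rw [pairing_incl hb]
  exact hK g hg hs hQ v

/-- The indicator function of a point. -/
def pointIndicator (p : ℂ) : ℂ → ℝ := Set.indicator {p} 1

@[simp] lemma pointIndicator_self (p : ℂ) : pointIndicator p p = 1 := by simp [pointIndicator]

lemma pointIndicator_of_ne {p q : ℂ} (h : q ≠ p) : pointIndicator p q = 0 := by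
  simp [pointIndicator, h]

lemma diffBound_pointIndicator (p : ℂ) : DiffBound 0 1 (pointIndicator p) :=
  DiffBound.of_norm_le fun q => by
    by_cases hq : q = p
    · subst hq; simp
    · simp [pointIndicator_of_ne hq]

/-- The value of a chain of order `0` at a function is determined by the values at points. -/
lemma pairing_eq_zero_of_order_zero {K : Chain2 0} {g : ℂ → ℝ} {C : ℝ} (hg : DiffBound 0 C g)
    (h : ∀ p, g p ≠ 0 → pairing 0 (scalarForm (pointIndicator p)) K = 0) :
    pairing 0 (scalarForm g) K = 0 := by
  classical
  have h1 := diffBound_pointIndicator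
  have hb : ∀ t : Finset ℂ, DiffBound 0 C (fun p => if p ∈ t then g p else 0) := fun t =>
    DiffBound.of_norm_le fun p => by
      split_ifs
      · exact hg.norm_le p
      · simpa using hg.nonneg
  have h0 : ∀ t : Finset ℂ, pairing 0 (scalarForm fun p => if p ∈ t then g p else 0) K = 0 := by
    intro t
    induction t using Finset.induction_on with
    | empty =>
      simp only [Finset.notMem_empty, if_false]
      have : scalarForm (fun _ : ℂ => (0 : ℝ)) = fun _ => 0 := by
        funext p; ext; simp
      rw [this, pairing_zero_form]
    | insert q t hq ih =>
      have e : scalarForm (fun p => if p ∈ insert q t then g p else 0)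
          = fun p => (g q • ContinuousLinearMap.id ℝ ℝ).comp (scalarForm (pointIndicator q) p)
            + scalarForm (fun p => if p ∈ t then g p else 0) p := by
        funext p
        ext
        by_cases hp : p = q
        · subst hp; simp [hq]
        · simp [hp, pointIndicator_of_ne hp]
      have hs : DiffBound 0 _ fun p => (g q • ContinuousLinearMap.id ℝ ℝ).comp
          (scalarForm (pointIndicator q) p) :=
        (h1 q).scalarForm.clm ((ContinuousLinearMap.compL ℝ ℝ ℝ ℝ)
          (g q • ContinuousLinearMap.id ℝ ℝ))
      rw [e, pairing_add hs (hb t).scalarForm, ih, pairing_clm (h1 q).scalarForm, add_zero]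
      by_cases hgq : g q = 0
      · simp [hgq]
      · rw [h q hgq, map_zero]
  -- The truncations of g to finite sets converge to g pointwise along the directed set of finite
  -- sets, all bounded by C. In order 0 no regularity is asked of them.
  have hlim := tendsto_pairing (l := (atTop : Filter (Finset ℂ)))
    (Eventually.of_forall fun t => (hb t).scalarForm) hg.scalarForm (fun p a =>
      (tendsto_const_nhds (x := scalarForm g p a)).congr' (by
        filter_upwards [eventually_ge_atTop {p}] with t ht
        simp [ht (Finset.mem_singleton_self p)])) K
  simp only [h0] at hlim
  exact tendsto_nhds_unique hlim tendsto_const_nhds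

/-- A chain of order `0` that is a multiple of Lebesgue measure on smooth functions in a ball does
not charge the points of the ball. -/
lemma pairing_single_eq_zero {K : Chain2 0} {z p : ℂ} {R d : ℝ} (hp : p ∈ Metric.ball z R)
    (hd : ∀ (h : ℂ → ℝ) (C : ℝ), DiffBound 1 C h →
      (∀ p, h p ≠ 0 → p ∈ Metric.closedBall z R) →
      pairing 1 (scalarForm h) (incl zero_le_one K) = d * ∫ p, h p) :
    pairing 0 (scalarForm (pointIndicator p)) K = 0 := by
  classical
  set b : ℕ → ℂ → ℝ := fun i => shrinkingBump p i with hb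
  have hb1 : ∀ i, DiffBound 0 1 (b i) := fun i => DiffBound.of_norm_le fun q => by
    rw [Real.norm_of_nonneg (shrinkingBump p i).nonneg]
    exact (shrinkingBump p i).le_one
  have hpt : ∀ q, Tendsto (fun i => b i q) atTop (𝓝 (pointIndicator p q)) := by
    intro q
    by_cases hq : q = p
    · subst hq
      refine tendsto_const_nhds.congr fun i => ?_
      rw [pointIndicator_self]
      exact ((shrinkingBump q i).one_of_mem_closedBall
        (Metric.mem_closedBall_self (shrinkingBump q i).rIn_pos.le)).symm
    · rw [pointIndicator_of_ne hq]
      refine tendsto_const_nhds.congr' ?_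
      filter_upwards [(tendsto_shrinkingBump_rOut p).eventually_lt_const (dist_pos.2 hq)] with i hi
      exact ((shrinkingBump p i).zero_of_le_dist hi.le).symm
  -- Shrinking bumps tend boundedly to the indicator of p, while their integrals, at most the areas
  -- of their discs, tend to 0.
  have hlim := tendsto_pairing (l := atTop) (Eventually.of_forall fun i => (hb1 i).scalarForm)
    (diffBound_pointIndicator p).scalarForm (fun q a => (hpt q).const_smul a) K
  have hint : Tendsto (fun i => ∫ q, b i q) atTop (𝓝 0) := by
    have hr := (tendsto_shrinkingBump_rOut p).pow 2 |>.mul_const Real.pi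
    simp only [ne_eq, OfNat.ofNat_ne_zero, not_false_eq_true, zero_pow, zero_mul] at hr
    refine squeeze_zero (fun i => integral_nonneg fun q => (shrinkingBump p i).nonneg)
      (fun i => ?_) hr
    refine ((shrinkingBump p i).integral_le_measure_closedBall volume).trans (le_of_eq ?_)
    rw [measureReal_def, Complex.volume_closedBall, ENNReal.toReal_mul, ENNReal.toReal_pow,
      ENNReal.toReal_ofReal (shrinkingBump p i).rOut_pos.le]
    simp
  have hlim0 : Tendsto (fun i => pairing 0 (scalarForm (b i)) K) atTop (𝓝 0) := by
    have := hint.const_mul d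
    rw [mul_zero] at this
    refine this.congr' ?_
    filter_upwards [(tendsto_shrinkingBump_rOut p).eventually_lt_const
      (sub_pos.2 (Metric.mem_ball.1 hp))] with i hi
    obtain ⟨C, hC⟩ := boundedDiffs_contDiffBump (shrinkingBump p i) 1
    rw [← pairing_incl hC.scalarForm zero_le_one, hd _ C hC]
    intro q hq
    have hq' : q ∈ Function.support (shrinkingBump p i) := hq
    rw [(shrinkingBump p i).support_eq, Metric.mem_ball] at hq'
    rw [Metric.mem_closedBall]
    linarith [dist_triangle q p z]
  exact tendsto_nhds_unique hlim hlim0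

/-- A `2`-chain is a multiple of Lebesgue measure in a ball where it has no boundary, and it vanishes
there if its order is zero. -/
lemma IsCycleOn.exists_const {s : ℕ} {K : Chain2 s} {z : ℂ} {R R' : ℝ} (hR : 0 < R)
    (hRR : R < R') (hK : IsCycleOn K (Metric.ball z R')) :
    ∃ d : ℝ, (s = 0 → d = 0) ∧ ∀ (h : ℂ → ℝ) (C : ℝ), DiffBound s C h →
      (∀ p, h p ≠ 0 → p ∈ Metric.closedBall z R) →
      pairing s (scalarForm h) K = d * ∫ p, h p := by
  rcases Nat.eq_zero_or_pos s with rfl | hs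
  -- The chain is viewed in order 1, on a disc of intermediate radius so that every point of the
  -- closed R-disc is interior.
  · obtain ⟨d, hd⟩ := (hK.incl zero_le_one).exists_const_of_one_le le_rfl
      (R := (R + R') / 2) (by linarith) (by linarith)
    refine ⟨0, fun _ => rfl, fun h C hC hh => ?_⟩
    rw [zero_mul]
    exact pairing_eq_zero_of_order_zero hC fun p hp => pairing_single_eq_zero
      (Metric.closedBall_subset_ball (by linarith) (hh p hp)) hd
  · obtain ⟨d, hd⟩ := hK.exists_const_of_one_le hs hR hRR
    exact ⟨d, fun h => absurd h hs.ne', hd⟩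

/-- A `2`-chain in the plane without boundary vanishes. -/
lemma IsCycleOn.eq_zero {s : ℕ} {K : Chain2 s} (hK : IsCycleOn K Set.univ) : K = 0 := by
  have hcpt : ∀ R : ℝ, 0 < R → ∀ (h : ℂ → ℝ) (C : ℝ), DiffBound s C h →
      (∀ p, h p ≠ 0 → p ∈ Metric.closedBall 0 R) → pairing s (scalarForm h) K = 0 := by
    intro R hR
    obtain ⟨d, -, hd⟩ := (hK.mono (Set.subset_univ (Metric.ball 0 (R + 1)))).exists_const hR
      (lt_add_one R)
    obtain ⟨φ, hφ, hb, hsupp, hint⟩ := exists_normalized_bump 0 hR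
    obtain ⟨C, hC⟩ := hb s
    have h1 := hd φ C hC hsupp
    rw [hint, mul_one] at h1
    have h2 : ∀ n : ℕ, pairing s (scalarForm fun p => φ (p - n)) K = d := fun n => by
      rw [← h1]
      exact hK.pairing_translate hφ (hasCompactSupport_of_ne_zero hsupp)
        fun _ _ _ _ => Set.mem_univ _
    have hz : DiffBound s 0 (fun _ : ℂ => (0 : ℝ)) := by
      have := (hC.clm (0 : ℝ →L[ℝ] ℝ))
      simpa using this
    -- The translates by n escape to infinity: they have the same difference bounds and are
    -- eventually 0 at each point, so their common pairing d is 0.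
    have h3 := tendsto_pairing (l := atTop)
      (Eventually.of_forall fun n : ℕ => (hC.comp_sub_right (n : ℂ)).scalarForm) hz.scalarForm
      (fun p a => tendsto_const_nhds.congr' (by
        obtain ⟨N, hN⟩ := exists_nat_gt (‖p‖ + R)
        filter_upwards [eventually_ge_atTop N] with n hn
        have : φ (p - n) = 0 := by
          by_contra h
          have := hsupp _ h
          rw [mem_closedBall_zero_iff] at this
          have h4 : ‖(n : ℂ)‖ ≤ ‖p‖ + ‖p - n‖ := by
            have := norm_sub_le p (p - n)
            rwa [sub_sub_cancel] at this
          rw [Complex.norm_natCast] at h4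
          have h5 : (N : ℝ) ≤ n := by exact_mod_cast hn
          linarith
        simp only [scalarForm_apply, this])) K
    simp only [h2] at h3
    have e : scalarForm (fun _ : ℂ => (0 : ℝ)) = fun _ => 0 := by
      funext p; ext; simp
    have hd0 : d = 0 := by
      refine tendsto_nhds_unique tendsto_const_nhds (?_ : Tendsto (fun _ : ℕ => d) atTop (𝓝 0))
      rwa [e, pairing_zero_form] at h3
    intro h D hD hh
    rw [hd h D hD hh, hd0, zero_mul]
  refine eq_zero_of_pairing_eq_zero K fun ω C hω => ?_
  refine pairing_eq_zero_of_cutoff hω K fun a D ha hD => ?_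
  obtain ⟨R, hR⟩ := ha.isCompact.isBounded.subset_closedBall 0
  obtain ⟨B, hB⟩ := (hD.smul hω).eval_one
  rw [← scalarForm_eval_one fun p => a p • ω p]
  refine hcpt (max R 1) (by positivity) _ B hB fun p hp => ?_
  refine Metric.closedBall_subset_closedBall (le_max_left _ _) (hR (subset_tsupport _ ?_))
  intro h
  simp [h] at hp

/-- A `2`-chain in the plane is determined by its boundary. -/
lemma IsBoundary.incl_eq {r s s' : ℕ} {J : Chain1 r} {K : Chain2 s} {K' : Chain2 s'}
    (h : IsBoundary K J) (h' : IsBoundary K' J) :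
    incl (le_max_right s s') K' = incl (le_max_left s s') K := by
  rw [← sub_eq_zero]
  refine IsCycleOn.eq_zero fun g hg hs _ v => ?_
  obtain ⟨C, hC⟩ := boundedDiffs_fderiv hg hs (max s s')
  have hb : DiffBound (max s s') _ (scalarForm fun p => fderiv ℝ g p v) :=
    (hC.clm (ContinuousLinearMap.apply ℝ ℝ v)).scalarForm
  rw [map_sub, pairing_incl hb, pairing_incl hb, sub_eq_zero]
  exact (h'.pairing_fderiv hg hs v).trans (h.pairing_fderiv hg hs v).symm

end Constancy

/-! ### Restriction to discs and the signed density. -/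

section Density

/-- The chain (p;1) - (q;1) is a first difference of size ‖p - q‖; it counts as such only in order
at least 1. -/
lemma continuous_ofPointed_elt {s : ℕ} (hs : 1 ≤ s) :
    Continuous fun p : ℂ => ofPointed s (elt p (1 : ℝ)) := by
  refine continuous_of_norm_sub_le (C := 1) fun p q => ?_
  have h := rnorm_diffs_le (r := s) (U := [p - q]) (by simpa using hs) q (1 : ℝ)
  rw [← map_sub, norm_ofPointed]
  simpa [diffs, diff_elt, size] using h

lemma norm_ofPointed_elt_le (s : ℕ) (p : ℂ) : ‖ofPointed s (elt p (1 : ℝ))‖ ≤ 1 := by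
  have := rnorm_diffs_le (r := s) (U := []) (Nat.zero_le _) p (1 : ℝ)
  simpa [norm_ofPointed, diffs, size] using this

lemma Func.integrable_smul {s : ℕ} (hs : 1 ≤ s) (f : Func ℂ s) {z : ℂ} {R : ℝ}
    (hf : ∀ p ∉ Metric.ball z R, f.val p = 0) :
    Integrable fun p => f.val p • ofPointed s (elt p (1 : ℝ)) := by
  obtain ⟨C, hC⟩ := f.diffBound
  refine ((hC.continuous hs).smul (continuous_ofPointed_elt hs)).integrable_of_hasCompactSupport
    (HasCompactSupport.smul_right ?_)
  refine hasCompactSupport_of_ne_zero (z := z) (R := R) fun p hp => ?_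
  by_contra h
  exact hp (hf p fun h' => h (Metric.ball_subset_closedBall h'))

/-- If `K` is `d` times Lebesgue measure in a ball, so is `m_f K` for functions `f` supported in the
ball. -/
lemma mul_eq_integral {s : ℕ} (hs : 1 ≤ s) {K : Chain2 s} {z : ℂ} {R d : ℝ}
    (hd : ∀ (h : ℂ → ℝ) (C : ℝ), DiffBound s C h →
      (∀ p, h p ≠ 0 → p ∈ Metric.closedBall z R) → pairing s (scalarForm h) K = d * ∫ p, h p)
    (f : Func ℂ s) (hf : ∀ p ∉ Metric.ball z R, f.val p = 0) :
    mul f K = d • ∫ p, f.val p • ofPointed s (elt p (1 : ℝ)) := by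
  rw [← sub_eq_zero]
  refine eq_zero_of_pairing_eq_zero _ fun ω C hω => ?_
  obtain ⟨D, hD⟩ := f.diffBound
  obtain ⟨B, hB⟩ := (hD.smul hω).eval_one
  rw [map_sub, map_smul, pairing_mul hω, ← ContinuousLinearMap.integral_comp_comm _
    (f.integrable_smul hs hf), ← scalarForm_eval_one fun p => f.val p • ω p, hd _ B hB]
  · simp only [map_smul, hω.pairing_ofPointed, evalForm_elt, smul_eq_mul, smul_apply, sub_self]
  · intro p hp
    by_contra h
    exact hp (by simp [hf p fun h' => h (Metric.ball_subset_closedBall h')])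

/-- In positive order the chains m_{fᵢ} K are Bochner integrals, and dominated convergence applies
with the indicator of the disc as majorant. In order 0 they all vanish. -/
lemma isRestriction_ball {s : ℕ} {K : Chain2 s} {z : ℂ} {R d : ℝ} (hs0 : s = 0 → d = 0)
    (hd : ∀ (h : ℂ → ℝ) (C : ℝ), DiffBound s C h →
      (∀ p, h p ≠ 0 → p ∈ Metric.closedBall z R) → pairing s (scalarForm h) K = d * ∫ p, h p) :
    IsRestriction K (Metric.ball z R)
      (d • ∫ p in Metric.ball z R, ofPointed s (elt p (1 : ℝ))) := by
  intro f hf01 hf0 hf1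
  rcases Nat.eq_zero_or_pos s with rfl | hs
  · obtain rfl := hs0 rfl
    rw [zero_smul]
    refine tendsto_const_nhds.congr fun i => (eq_zero_of_pairing_eq_zero _ fun ω C hω => ?_).symm
    obtain ⟨D, hD⟩ := (f i).diffBound
    obtain ⟨B, hB⟩ := (hD.smul hω).eval_one
    rw [pairing_mul hω, ← scalarForm_eval_one fun p => (f i).val p • ω p, hd _ B hB, zero_mul]
    intro p hp
    by_contra h
    exact hp (by simp [hf0 i p fun h' => h (Metric.ball_subset_closedBall h')])
  · simp only [mul_eq_integral hs hd _ (hf0 _)]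
    refine Tendsto.const_smul ?_ d
    rw [← integral_indicator measurableSet_ball]
    refine tendsto_integral_of_dominated_convergence ((Metric.ball z R).indicator fun _ => (1 : ℝ))
      (fun i => ((f i).integrable_smul hs (hf0 i)).aestronglyMeasurable) ?_
      (fun i => Eventually.of_forall fun p => ?_) (Eventually.of_forall fun p => ?_)
    · rw [integrable_indicator_iff measurableSet_ball]
      exact integrableOn_const (measure_ball_lt_top.ne)
    · by_cases hp : p ∈ Metric.ball z R
      · rw [Set.indicator_of_mem hp, norm_smul, Real.norm_of_nonneg (hf01 i p).1]
        exact mul_le_one₀ (hf01 i p).2 (norm_nonneg _) (norm_ofPointed_elt_le s p)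
      · simp [Set.indicator_of_notMem hp, hf0 i p hp]
    · by_cases hp : p ∈ Metric.ball z R
      · rw [Set.indicator_of_mem hp]
        simpa using (hf1 p hp).smul_const (ofPointed s (elt p (1 : ℝ)))
      · simp [Set.indicator_of_notMem hp, hf0 _ p hp]

/-- The integral of dv over the explicit restriction is d times the area, so the quotient is d for
each ε > 0, before any limit. -/
lemma hasSignedDensity_of_const {s : ℕ} {K : Chain2 s} {z : ℂ} {R d : ℝ} (hR : 0 < R)
    (hs0 : s = 0 → d = 0)
    (hd : ∀ (h : ℂ → ℝ) (C : ℝ), DiffBound s C h →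
      (∀ p, h p ≠ 0 → p ∈ Metric.closedBall z R) → pairing s (scalarForm h) K = d * ∫ p, h p) :
    HasSignedDensity K z d := by
  refine ⟨fun ε => d • ∫ p in Metric.ball z ε, ofPointed s (elt p (1 : ℝ)), ?_, ?_⟩
  · filter_upwards [Ioo_mem_nhdsGT hR] with ε hε
    exact isRestriction_ball hs0 fun h C hC hh => hd h C hC fun p hp =>
      Metric.closedBall_subset_closedBall hε.2.le (hh p hp)
  · refine tendsto_const_nhds.congr' ?_
    filter_upwards [self_mem_nhdsWithin] with ε hε
    rw [integral_eq_pairing, map_smul]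
    rcases Nat.eq_zero_or_pos s with rfl | hs
    · simp [hs0 rfl]
    obtain ⟨C, hC⟩ := (volumeForm s).diffBound
    have hint : IntegrableOn (fun p : ℂ => ofPointed s (elt p (1 : ℝ))) (Metric.ball z ε) :=
      ((continuous_ofPointed_elt hs).continuousOn.integrableOn_compact
        (isCompact_closedBall z ε)).mono_set Metric.ball_subset_closedBall
    rw [← ContinuousLinearMap.integral_comp_comm _ hint]
    simp only [hC.pairing_ofPointed, evalForm_elt]
    have hv : volume.real (Metric.ball z ε) ≠ 0 :=
      (ENNReal.toReal_pos (Metric.measure_ball_pos volume z hε).ne' measure_ball_lt_top.ne).ne'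
    simp only [volumeForm, ContinuousLinearMap.id_apply, integral_const, smul_eq_mul, mul_one,
      measureReal_restrict_apply MeasurableSet.univ, Set.univ_inter]
    field_simp

end Density

/-! ### The Cauchy kernel with a radial cutoff. -/

section CauchyKernel

lemma exists_transition {a : ℝ} (ha : 0 < a) : ∃ θ : ℝ → ℝ, ContDiff ℝ (⊤ : ℕ∞) θ ∧
    (∀ t ≤ a, θ t = 0) ∧ ∀ t, 2 * a ≤ t → θ t = 1 := by
  refine ⟨fun t => Real.smoothTransition (t / a - 1), ?_, fun t ht => ?_, fun t ht => ?_⟩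
  · exact Real.smoothTransition.contDiff.comp ((contDiff_id.div_const a).sub contDiff_const)
  · refine Real.smoothTransition.zero_of_nonpos ?_
    rw [sub_nonpos, div_le_one ha]
    exact ht
  · refine Real.smoothTransition.one_of_one_le ?_
    rw [le_sub_iff_add_le, le_div_iff₀ ha]
    linarith

variable {θ : ℝ → ℝ} {a : ℝ}

lemma mem_Icc_of_deriv_ne_zero (h0 : ∀ t ≤ a, θ t = 0) (h1 : ∀ t, 2 * a ≤ t → θ t = 1) {t : ℝ}
    (ht : deriv θ t ≠ 0) : t ∈ Set.Icc a (2 * a) := by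
  by_contra h
  rw [Set.mem_Icc, not_and_or, not_le, not_le] at h
  refine ht ?_
  rcases h with h | h
  · have : θ =ᶠ[𝓝 t] fun _ => 0 := by
      filter_upwards [gt_mem_nhds h] with u hu using h0 u hu.le
    rw [this.deriv_eq, deriv_const]
  · have : θ =ᶠ[𝓝 t] fun _ => 1 := by
      filter_upwards [lt_mem_nhds h] with u hu using h1 u hu.le
    rw [this.deriv_eq, deriv_const]

lemma contDiff_of_eventually_zero {G : Type} [NormedAddCommGroup G] [NormedSpace ℝ G]
    {f : ℂ → G} (h : ∀ w, w ≠ 0 → ContDiffAt ℝ (⊤ : ℕ∞) f w) (h0 : f =ᶠ[𝓝 0] fun _ => 0) :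
    ContDiff ℝ (⊤ : ℕ∞) f := by
  rw [contDiff_iff_contDiffAt]
  intro w
  rcases eq_or_ne w 0 with rfl | hw
  · exact contDiffAt_const.congr_of_eventuallyEq h0
  · exact h w hw

lemma contDiff_radial (hθ : ContDiff ℝ (⊤ : ℕ∞) θ) :
    ContDiff ℝ (⊤ : ℕ∞) fun w : ℂ => θ (‖w‖ ^ 2) :=
  hθ.comp (contDiff_norm_sq ℝ)

lemma fderiv_radial (hθ : ContDiff ℝ (⊤ : ℕ∞) θ) (w v : ℂ) :
    fderiv ℝ (fun w : ℂ => θ (‖w‖ ^ 2)) w v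
      = deriv θ (‖w‖ ^ 2) * (2 * (w.re * v.re + w.im * v.im)) := by
  have h1 := (hθ.differentiable (by simp) (‖w‖ ^ 2)).hasDerivAt.comp_hasFDerivAt w
    (hasStrictFDerivAt_norm_sq w).hasFDerivAt
  have h2 : HasFDerivAt (fun w : ℂ => θ (‖w‖ ^ 2)) _ w := h1
  rw [h2.fderiv]
  simp only [smul_apply, innerSL_apply_apply, Complex.inner, smul_eq_mul, nsmul_eq_mul]
  simp
  left
  ring

lemma radial_eventuallyEq_zero (ha : 0 < a) (h0 : ∀ t ≤ a, θ t = 0) :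
    ∀ᶠ w : ℂ in 𝓝 0, θ (‖w‖ ^ 2) = 0 := by
  have hc : Continuous fun w : ℂ => ‖w‖ ^ 2 := by fun_prop
  have : ∀ᶠ w : ℂ in 𝓝 0, ‖w‖ ^ 2 < a :=
    hc.continuousAt.eventually_lt_const (by simpa using ha)
  exact this.mono fun w hw => h0 _ hw.le

lemma contDiffAt_inv_pow (k : ℕ) {w : ℂ} (hw : w ≠ 0) :
    ContDiffAt ℝ (⊤ : ℕ∞) (fun w : ℂ => w⁻¹ ^ k) w :=
  ((contDiffAt_id (𝕜 := ℝ)).inv hw).pow k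

/-- The function `θ(|w|²) w^{-k}`. -/
def cutKernel (θ : ℝ → ℝ) (k : ℕ) (w : ℂ) : ℂ := θ (‖w‖ ^ 2) • w⁻¹ ^ k

lemma contDiff_cutKernel (ha : 0 < a) (hθ : ContDiff ℝ (⊤ : ℕ∞) θ) (h0 : ∀ t ≤ a, θ t = 0)
    (k : ℕ) : ContDiff ℝ (⊤ : ℕ∞) (cutKernel θ k) := by
  refine contDiff_of_eventually_zero (fun w hw => ?_) ?_
  · exact (contDiff_radial hθ).contDiffAt.smul (contDiffAt_inv_pow k hw)
  · filter_upwards [radial_eventuallyEq_zero ha h0] with w hw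
    simp [cutKernel, hw]

/-- The derivative of `cutKernel`. -/
def cutKernelDeriv (θ : ℝ → ℝ) (k : ℕ) (w : ℂ) : ℂ →L[ℝ] ℂ :=
  (fderiv ℝ (fun w : ℂ => θ (‖w‖ ^ 2)) w).smulRight (w⁻¹ ^ k)
    + (-(k : ℝ)) • ContinuousLinearMap.mul ℝ ℂ (cutKernel θ (k + 1) w)

lemma hasFDerivAt_cutKernel (ha : 0 < a) (hθ : ContDiff ℝ (⊤ : ℕ∞) θ) (h0 : ∀ t ≤ a, θ t = 0)
    (k : ℕ) (w : ℂ) : HasFDerivAt (cutKernel θ k) (cutKernelDeriv θ k w) w := by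
  rcases eq_or_ne w 0 with rfl | hw
  · have e : cutKernel θ k =ᶠ[𝓝 0] fun _ => 0 := by
      filter_upwards [radial_eventuallyEq_zero ha h0] with w hw
      simp [cutKernel, hw]
    have e2 : (fun w : ℂ => θ (‖w‖ ^ 2)) =ᶠ[𝓝 0] fun _ => 0 :=
      radial_eventuallyEq_zero ha h0
    have := (hasFDerivAt_const (𝕜 := ℝ) (0 : ℂ) (0 : ℂ)).congr_of_eventuallyEq e
    convert this using 1
    rw [cutKernelDeriv, e2.fderiv_eq]
    ext; simp [cutKernel]
  · have h1 : HasDerivAt (fun w : ℂ => w⁻¹ ^ k) (-(k : ℂ) * w⁻¹ ^ (k + 1)) w := by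
      refine ((hasDerivAt_inv hw).fun_pow k).congr_deriv ?_
      cases k with
      | zero => simp
      | succ k => simp only [Nat.add_sub_cancel, pow_succ]; field_simp
    have h2 := ((contDiff_radial hθ).differentiable (by simp) w).hasFDerivAt.smul
      (h1.hasFDerivAt.restrictScalars ℝ)
    refine HasFDerivAt.congr_fderiv (f := cutKernel θ k) h2 ?_
    ext
    simp [cutKernel, cutKernelDeriv]
    ring

/-- The derivative of the cutoff vanishes near 0 and far away, so the field is smooth with compact
support despite the pole. -/
lemma boundedDiffs_fderiv_radial (ha : 0 < a) (hθ : ContDiff ℝ (⊤ : ℕ∞) θ)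
    (h0 : ∀ t ≤ a, θ t = 0) (h1 : ∀ t, 2 * a ≤ t → θ t = 1) (k : ℕ) : BoundedDiffs fun w : ℂ =>
      (fderiv ℝ (fun w : ℂ => θ (‖w‖ ^ 2)) w).smulRight (w⁻¹ ^ k) := by
  have hd : ContDiff ℝ (⊤ : ℕ∞) (fderiv ℝ fun w : ℂ => θ (‖w‖ ^ 2)) :=
    (contDiff_radial hθ).fderiv_right (m := (⊤ : ℕ∞)) (by simp)
  refine boundedDiffs_of_hasCompactSupport (contDiff_of_eventually_zero (fun w hw => ?_) ?_) ?_
  · exact hd.contDiffAt.smulRight (contDiffAt_inv_pow k hw)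
  · have e2 : (fun w : ℂ => θ (‖w‖ ^ 2)) =ᶠ[𝓝 0] fun _ => 0 :=
      radial_eventuallyEq_zero ha h0
    filter_upwards [e2.fderiv (𝕜 := ℝ)] with w hw
    rw [hw]
    ext; simp
  · refine HasCompactSupport.of_support_subset_isCompact
      (isCompact_closedBall (0 : ℂ) (max 1 (2 * a))) fun w hw => ?_
    rw [mem_closedBall_zero_iff]
    by_contra h
    rw [not_le, max_lt_iff] at h
    refine hw ?_
    have hz : deriv θ (‖w‖ ^ 2) = 0 := by
      by_contra hne
      have := (mem_Icc_of_deriv_ne_zero h0 h1 hne).2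
      nlinarith
    ext; simp [fderiv_radial hθ, hz]

/-- The derivative is a compactly supported term plus -k times the kernel with exponent k + 1. The
induction on the order therefore runs over all k at once, although only k = 1 is used for the Cauchy
form. -/
lemma boundedDiffs_cutKernel (ha : 0 < a) (hθ : ContDiff ℝ (⊤ : ℕ∞) θ) (h0 : ∀ t ≤ a, θ t = 0)
    (h1 : ∀ t, 2 * a ≤ t → θ t = 1) (k : ℕ) : BoundedDiffs (cutKernel θ k) := by
  have hbdd : ∀ k, ∃ C, ∀ w, ‖cutKernel θ k w‖ ≤ C := by
    intro k
    -- Beyond this radius both |w| > 1 and |w|² ≥ 2a hold, so the kernel is w^{-k}, of norm at most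
    -- 1.
    obtain ⟨C, hC⟩ := (isCompact_closedBall (0 : ℂ) (max 1 (2 * a))).exists_bound_of_continuousOn
      (contDiff_cutKernel ha hθ h0 k).continuous.continuousOn
    refine ⟨max C 1, fun w => ?_⟩
    by_cases hw : w ∈ Metric.closedBall (0 : ℂ) (max 1 (2 * a))
    · exact (hC w hw).trans (le_max_left _ _)
    · rw [mem_closedBall_zero_iff, not_le, max_lt_iff] at hw
      have h2 : 2 * a ≤ ‖w‖ ^ 2 := by nlinarith
      rw [cutKernel, h1 _ h2, one_smul, norm_pow, norm_inv]
      exact (pow_le_one₀ (by positivity) (inv_le_one_of_one_le₀ hw.1.le)).trans (le_max_right _ _)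
  intro r
  induction r generalizing k with
  | zero =>
    obtain ⟨C, hC⟩ := hbdd k
    exact ⟨C, DiffBound.of_norm_le hC⟩
  | succ r ih =>
    obtain ⟨C, hC⟩ := hbdd k
    obtain ⟨B, hB⟩ := boundedDiffs_fderiv_radial ha hθ h0 h1 k r
    obtain ⟨D, hD⟩ := ih (k + 1)
    have h2 := hB.add (hD.clm ((-(k : ℝ)) • ContinuousLinearMap.mul ℝ ℂ))
    exact ⟨_, DiffBound.of_hasFDerivAt (hasFDerivAt_cutKernel ha hθ h0 k)
      (fun p => (hC p).trans (le_max_left C _)) (h2.mono_const (le_max_right _ _))⟩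

lemma boundedDiffs_cutKernelDeriv (ha : 0 < a) (hθ : ContDiff ℝ (⊤ : ℕ∞) θ)
    (h0 : ∀ t ≤ a, θ t = 0) (h1 : ∀ t, 2 * a ≤ t → θ t = 1) (k : ℕ) :
    BoundedDiffs (cutKernelDeriv θ k) :=
  (boundedDiffs_fderiv_radial ha hθ h0 h1 k).add
    ((boundedDiffs_cutKernel ha hθ h0 h1 (k + 1)).clm
      ((-(k : ℝ)) • ContinuousLinearMap.mul ℝ ℂ))

/-- The complex linear part of the derivative has no curl. What remains comes from the cutoff, with
numerator 2 i w θ' that cancels the factor w⁻¹; at the origin θ' is 0. -/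
lemma cutKernelDeriv_one_curl (ha : 0 < a) (hθ : ContDiff ℝ (⊤ : ℕ∞) θ)
    (h0 : ∀ t ≤ a, θ t = 0) (h1 : ∀ t, 2 * a ≤ t → θ t = 1) (w : ℂ) :
    cutKernelDeriv θ 1 w 1 * Complex.I - cutKernelDeriv θ 1 w Complex.I
      = deriv θ (‖w‖ ^ 2) * (2 * Complex.I) := by
  have e : cutKernelDeriv θ 1 w 1 * Complex.I - cutKernelDeriv θ 1 w Complex.I
      = deriv θ (‖w‖ ^ 2) * (2 * (w.re * Complex.I - w.im)) * w⁻¹ := by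
    simp [cutKernelDeriv, fderiv_radial hθ]
    ring
  rw [e]
  rcases eq_or_ne w 0 with rfl | hw
  · have : deriv θ 0 = 0 := by
      by_contra h
      have := (mem_Icc_of_deriv_ne_zero h0 h1 h).1
      linarith
    simp [this]
  · have h2 : w.re * Complex.I - w.im = Complex.I * w := by
      conv_rhs => rw [← Complex.re_add_im w]
      ring_nf
      simp
      ring
    rw [h2]
    field_simp

/-- In polar coordinates the integral is 2π ∫ y θ'(y²) dy over y > 0, and y θ'(y²) has primitive
θ(y²) / 2, which rises from 0 to 1/2. -/
lemma integral_deriv_radial (ha : 0 < a) (hθ : ContDiff ℝ (⊤ : ℕ∞) θ) (h0 : ∀ t ≤ a, θ t = 0)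
    (h1 : ∀ t, 2 * a ≤ t → θ t = 1) (z : ℂ) :
    ∫ w : ℂ, deriv θ (‖w - z‖ ^ 2) = Real.pi := by
  rw [integral_sub_right_eq_self (fun w : ℂ => deriv θ (‖w‖ ^ 2)) z,
    integral_fun_norm_addHaar volume fun t => deriv θ (t ^ 2)]
  have hc : Continuous fun y : ℝ => y * deriv θ (y ^ 2) :=
    continuous_id.mul ((hθ.continuous_deriv (by simp)).comp (continuous_pow 2))
  have hs : HasCompactSupport fun y : ℝ => y * deriv θ (y ^ 2) := by
    refine HasCompactSupport.of_support_subset_isCompact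
      (isCompact_closedBall (0 : ℝ) (max 1 (2 * a))) fun y hy => ?_
    rw [mem_closedBall_zero_iff, Real.norm_eq_abs]
    by_contra h
    rw [not_le, max_lt_iff] at h
    have := (mem_Icc_of_deriv_ne_zero h0 h1 (right_ne_zero_of_mul hy)).2
    rw [← sq_abs] at this
    nlinarith
  have hd : ∀ y : ℝ, HasDerivAt (fun y => θ (y ^ 2) / 2) (y * deriv θ (y ^ 2)) y := by
    intro y
    have h2 := ((hθ.differentiable (by simp) (y ^ 2)).hasDerivAt.comp y
      (hasDerivAt_pow 2 y)).div_const 2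
    refine HasDerivAt.congr_deriv (f := fun y => θ (y ^ 2) / 2) h2 ?_
    simp
    ring
  have ht : Tendsto (fun y : ℝ => θ (y ^ 2) / 2) atTop (𝓝 (1 / 2)) := by
    refine tendsto_const_nhds.congr' ?_
    filter_upwards [eventually_ge_atTop (max 1 (2 * a))] with y hy
    rw [max_le_iff] at hy
    rw [h1 _ (by nlinarith)]
  have hI := integral_Ioi_of_hasDerivAt_of_tendsto (a := 0) (hd 0).continuousAt.continuousWithinAt
    (fun y _ => hd y) (hc.integrable_of_hasCompactSupport hs).integrableOn ht
  have h00 : θ 0 = 0 := h0 0 ha.le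
  simp only [ne_eq, OfNat.ofNat_ne_zero, not_false_eq_true, zero_pow, h00, zero_div,
    sub_zero] at hI
  rw [Complex.finrank_real_complex, measureReal_def, Complex.volume_ball]
  simp only [Nat.add_one_sub_one, pow_one, smul_eq_mul, hI]
  simp
  ring

end CauchyKernel

/-! ### The winding number. -/

section Winding

/-- Two admissible extensions agree on the intersection of their neighbourhoods, so their difference
vanishes near the support. -/
lemma hasIntegral_of_form {r : ℕ} {J : Chain1 r} {ω : ℂ → ℂ →L[ℝ] ℂ} {η : ℂ → ℂ →L[ℝ] ℂ}
    {C : ℝ} (hη : DiffBound r C η) {O : Set ℂ} (hO : IsOpen O) (hJ : supp J ⊆ O)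
    (h : ∀ w ∈ O, η w = ω w) : HasIntegral J ω (pairing r η J) := by
  refine ⟨⟨hη.toForm, O, hO, hJ, h⟩, ?_⟩
  rintro ζ ⟨O', hO', hJ', h'⟩
  obtain ⟨D, hD⟩ := ζ.diffBound
  rw [integral_eq_pairing, ← sub_eq_zero, ← pairing_sub hD hη]
  refine pairing_eq_zero_of_supp (hD.sub hη) (hO.inter hO') (Set.subset_inter hJ hJ') ?_
  rintro w ⟨hw, hw'⟩
  rw [h w hw, h' w hw', sub_self]

/-- The form `θ(|w - z|²) dw / (w - z)`. -/
def cutCauchyForm (θ : ℝ → ℝ) (z w : ℂ) : ℂ →L[ℝ] ℂ :=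
  ContinuousLinearMap.mul ℝ ℂ (cutKernel θ 1 (w - z))

/-- The derivative of `cutCauchyForm`. -/
def cutCauchyFormDeriv (θ : ℝ → ℝ) (z w : ℂ) : ℂ →L[ℝ] ℂ →L[ℝ] ℂ :=
  (ContinuousLinearMap.mul ℝ ℂ).comp (cutKernelDeriv θ 1 (w - z))

variable {θ : ℝ → ℝ} {a : ℝ}

lemma boundedDiffs_cutCauchyForm (ha : 0 < a) (hθ : ContDiff ℝ (⊤ : ℕ∞) θ)
    (h0 : ∀ t ≤ a, θ t = 0) (h1 : ∀ t, 2 * a ≤ t → θ t = 1) (z : ℂ) :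
    BoundedDiffs (cutCauchyForm θ z) :=
  ((boundedDiffs_cutKernel ha hθ h0 h1 1).comp_sub_right z).clm (ContinuousLinearMap.mul ℝ ℂ)

lemma boundedDiffs_cutCauchyFormDeriv (ha : 0 < a) (hθ : ContDiff ℝ (⊤ : ℕ∞) θ)
    (h0 : ∀ t ≤ a, θ t = 0) (h1 : ∀ t, 2 * a ≤ t → θ t = 1) (z : ℂ) :
    BoundedDiffs (cutCauchyFormDeriv θ z) :=
  ((boundedDiffs_cutKernelDeriv ha hθ h0 h1 1).comp_sub_right z).clm_comp
    (ContinuousLinearMap.mul ℝ ℂ)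

lemma hasFDerivAt_cutCauchyForm (ha : 0 < a) (hθ : ContDiff ℝ (⊤ : ℕ∞) θ)
    (h0 : ∀ t ≤ a, θ t = 0) (z w : ℂ) :
    HasFDerivAt (cutCauchyForm θ z) (cutCauchyFormDeriv θ z w) w := by
  have h2 := (hasFDerivAt_comp_add_right (-z)).2 (hasFDerivAt_cutKernel ha hθ h0 1 (w + -z))
  simp only [← sub_eq_add_neg] at h2
  exact (ContinuousLinearMap.mul ℝ ℂ).hasFDerivAt.comp w h2

lemma extDeriv_cutCauchyFormDeriv (ha : 0 < a) (hθ : ContDiff ℝ (⊤ : ℕ∞) θ)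
    (h0 : ∀ t ≤ a, θ t = 0) (h1 : ∀ t, 2 * a ≤ t → θ t = 1) (z : ℂ) :
    extDeriv (cutCauchyFormDeriv θ z) = fun w =>
      ((ContinuousLinearMap.id ℝ ℝ).smulRight (2 * Complex.I)).comp
        (scalarForm (fun w : ℂ => deriv θ (‖w - z‖ ^ 2)) w) := by
  funext w
  ext
  rw [extDeriv_one]
  have h := cutKernelDeriv_one_curl ha hθ h0 h1 (w - z)
  simp only [cutCauchyFormDeriv, ContinuousLinearMap.comp_apply, ContinuousLinearMap.mul_apply',
    mul_one, h]
  simp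

/-- Stokes' formula moves the integral to K, where it is the pairing with 2i θ'(|w - z|²). Since K
is d · Lebesgue there, the value is 2i d π. -/
lemma hasWindingNumber_of_const {r s : ℕ} {K : Chain2 s} {J : Chain1 r} (hKJ : IsBoundary K J)
    {z : ℂ} {R d : ℝ} (hR : 0 < R) (hz : supp J ⊆ (Metric.closedBall z R)ᶜ)
    (hd : ∀ (h : ℂ → ℝ) (C : ℝ), DiffBound s C h →
      (∀ p, h p ≠ 0 → p ∈ Metric.closedBall z R) → pairing s (scalarForm h) K = d * ∫ p, h p) :
    HasWindingNumber J z d := by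
  -- With a = R² / 2 the cutoff reaches 1 at |w - z| = R: outside the disc the form is the Cauchy
  -- form, and the exterior derivative lives inside.
  have ha : 0 < R ^ 2 / 2 := by positivity
  obtain ⟨θ, hθ, h0, h1⟩ := exists_transition ha
  have hηb := boundedDiffs_cutCauchyForm ha hθ h0 h1 z
  obtain ⟨C, hC⟩ := hηb r
  refine ⟨pairing r (cutCauchyForm θ z) J,
    hasIntegral_of_form hC Metric.isClosed_closedBall.isOpen_compl hz fun w hw => ?_, ?_⟩
  · have h2 : R < ‖w - z‖ := by
      simpa [dist_eq_norm] using hw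
    have h3 : θ (‖w - z‖ ^ 2) = 1 := h1 _ (by nlinarith)
    ext
    simp [cutCauchyForm, cutKernel, cauchyForm, h3]
  have hgs : ∀ w : ℂ, deriv θ (‖w - z‖ ^ 2) ≠ 0 → w ∈ Metric.closedBall z R := fun w hw => by
    have := (mem_Icc_of_deriv_ne_zero h0 h1 hw).2
    rw [mem_closedBall_iff_norm]
    exact le_of_sq_le_sq (by linarith) hR.le
  have hgc : ContDiff ℝ (⊤ : ℕ∞) fun w : ℂ => deriv θ (‖w - z‖ ^ 2) :=
    (contDiff_radial ((contDiff_infty_iff_deriv.1 hθ).2)).comp (contDiff_id.sub contDiff_const)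
  obtain ⟨D, hD⟩ := boundedDiffs_of_hasCompactSupport hgc (hasCompactSupport_of_ne_zero hgs) s
  rw [hKJ.pairing_eq hηb (hasFDerivAt_cutCauchyForm ha hθ h0 z)
    (boundedDiffs_cutCauchyFormDeriv ha hθ h0 h1 z), extDeriv_cutCauchyFormDeriv ha hθ h0 h1,
    pairing_clm hD.scalarForm, hd _ D hD hgs, integral_deriv_radial ha hθ h0 h1]
  simp
  field_simp
  simp

end Winding

end DiffChain

end

theorem mainTheorem6 (r s : ℕ) (hr : 1 ≤ r) (J : DiffChain.Chain1 r)
    (hJ : DiffChain.boundary1 hr J = 0)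
    (K : DiffChain.Chain2 s) (hK : DiffChain.mass K < ⊤) (hKJ : DiffChain.IsBoundary K J) :
    (∀ z ∉ DiffChain.supp J, ∃ d : ℝ,
      DiffChain.HasWindingNumber J z d ∧ DiffChain.HasSignedDensity K z d) ∧
    ∀ (s' : ℕ) (K' : DiffChain.Chain2 s'), DiffChain.IsBoundary K' J →
      DiffChain.incl (le_max_right s s') K' = DiffChain.incl (le_max_left s s') K := by
  refine ⟨fun z hz => ?_, fun s' K' hK' => hKJ.incl_eq hK'⟩
  obtain ⟨δ, hδ, hball⟩ := Metric.isOpen_iff.1 (DiffChain.isClosed_supp J).isOpen_compl z hz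
  -- Half of δ leaves the margin that the translation argument needs.
  obtain ⟨d, hd0, hd⟩ := (hKJ.isCycleOn.mono hball).exists_const (half_pos hδ) (half_lt_self hδ)
  refine ⟨d, DiffChain.hasWindingNumber_of_const hKJ (half_pos hδ) ?_ hd,
    DiffChain.hasSignedDensity_of_const (half_pos hδ) hd0 hd⟩
  rw [Set.subset_compl_comm]
  exact (Metric.closedBall_subset_ball (half_lt_self hδ)).trans hball
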